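/- Let $\Sigma$ (constants) and $\Pi$ (parameters) be disjoint alphabets, with $\Pi$ finite. Two strings $x,y$ over $\Sigma\cup\Pi$ *p-match*, written $x\equiv y$, if there is a permutation $f$ of $\Pi$ which, extended by $f(c)=c$ for $c\in\Sigma$ and applied letter by letter, maps $x$ to $y$. For a text $T$ of length $n$ and a pattern $P$ of length $m$, the parameterized matching problem asks for all $i$ with $0\le i\le n-m$ such that $T[i:i+m]\equiv P$, where $T[i:i+m]=T[i]\cdots T[i+m-1]$. Let $\Pi_P$ be the set of parameters that appear in $P$. The computing model is a deterministic random access machine with unit-cost operations on words (arithmetic including multiplication and division with rounding, comparisons, indirect addressing). $T$, $P$ and $|\Pi|$ are given in read-only input; each letter is given by a number, the parameters being numbered $0,\dots,|\Pi|-1$ (so that functions $\Pi\to\mathbb N$ can be stored as arrays) and the constants having distinct numbers $\ge|\Pi|$. The output is write-only. The extra space is the number of registers and work memory words, all initially $0$. **Theorem.** There are one program and one constant $C$ such that, for all such $\Sigma,\Pi$, all numberings of the letters, all $T,P$, and every word range $\{0,\dots,W-1\}$ that contains the numbers of the letters of $T$ and $P$ and satisfies $W\ge(n+m+|\Pi|+2)^C$,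 the program run on $(T,P)$ stores and computes only numbers less than $W$, halts, outputs exactly the $i$ with $0\le i\le n-m$ and $T[i:i+m]\equiv P$, each once and in increasing order, takes at most $$C\,\bigl(\max(1,|\Pi_P|)\cdot n+m+1\bigr)$$ steps, and uses at most $$C\,\bigl(\lfloor\log_2 m\rfloor+|\Pi|+1\bigr)$$ words of extra space (with $\lfloor\log_2 0\rfloor$ read as $0$). In particular, if $\Pi_P\ne\emptyset$, the parameterized matching problem is solved in $O(|\Pi_P|\,n+m)$ time and $O(\log m+|\Pi|)$ extra space. -/

import Mathlib

namespace ParamMatch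

/-! ### Parameterized strings -/

/-- A p-string: a finite word whose letters are constants (`Sum.inl`) or parameters (`Sum.inr`). -/
abbrev PString (Con Par : Type*) := List (Con ⊕ Par)

/-- Two p-strings p-match if some permutation of the parameter alphabet, extended by the identity on
constants and applied letter by letter, maps the first one to the second one. -/
def PMatch {Con Par : Type*} (x y : PString Con Par) : Prop :=
  ∃ f : Equiv.Perm Par, x.map (Sum.map id f) = y

/-- The substring `w[i : j]`. -/
def substr {Con Par : Type*} (w : PString Con Par) (i j : ℕ) : PString Con Par :=
  (w.take j).drop i

/-- The set of parameters that appear in a p-string. -/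
def paramSet {Con Par : Type*} (w : PString Con Par) : Set Par :=
  {c | Sum.inr c ∈ w}

/-- `i` is a solution of the parameterized matching problem for text `T` and pattern `P`. -/
def IsOccurrence {Con Par : Type*} (T P : PString Con Par) (i : ℕ) : Prop :=
  i + P.length ≤ T.length ∧ PMatch (substr T i (i + P.length)) P

/-- The number by which a letter is presented to a machine: the parameters are numbered
`0, …, |Π| - 1`, so that they can serve as array indices, and the constants get pairwise distinct
numbers that are at least `|Π|`. -/
def letterCode {Con Par : Type*} [Fintype Par] (par : Par ≃ Fin (Fintype.card Par))
    (con : Con ↪ ℕ) : Con ⊕ Par → ℕ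
  | Sum.inl a => Fintype.card Par + con a
  | Sum.inr c => par c

/-! ### The machine model

A random access machine with unit cost operations on words.  The input (text, pattern and the size of
the parameter alphabet) is read-only, the output is write-only, and the machine can change only its
`k` registers and `S` memory cells.  Every word is a natural number less than `W`.  An operation whose
result is not a word, or an access outside the text, the pattern or the memory, is a fault: such an
execution does not terminate normally. -/

/-- The read-only input of a machine. -/
structure Input where
  text : List ℕ
  pat : List ℕ
  numParams : ℕ

/-- The machine input that presents text `T` and pattern `P`. -/
def encodeInput {Con Par : Type*} [Fintype Par] (par : Par ≃ Fin (Fintype.card Par))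
    (con : Con ↪ ℕ) (T P : PString Con Par) : Input where
  text := T.map (letterCode par con)
  pat := P.map (letterCode par con)
  numParams := Fintype.card Par

/-- Arithmetic and comparison operations. -/
inductive Op where
  | add | sub | mul | div | lt | eq

/-- Subtraction is truncated at `0`, division rounds down (and `a / 0 = 0`), and comparisons return
`1` for true and `0` for false. -/
def Op.eval : Op → ℕ → ℕ → ℕ
  | .add, a, b => a + b
  | .sub, a, b => a - b
  | .mul, a, b => a * b
  | .div, a, b => a / b
  | .lt, a, b => if a < b then 1 else 0
  | .eq, a, b => if a = b then 1 else 0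

/-- Expressions over `k` registers. -/
inductive Expr (k : ℕ) where
  | lit (c : ℕ)
  | reg (r : Fin k)
  | textLen
  | patLen
  | numParams
  | text (i : Expr k)
  | pat (i : Expr k)
  | mem (i : Expr k)
  | bin (o : Op) (a b : Expr k)

/-- Programs over `k` registers. -/
inductive Cmd (k : ℕ) where
  | skip
  | assign (r : Fin k) (e : Expr k)
  | store (i e : Expr k)
  | output (e : Expr k)
  | seq (c d : Cmd k)
  | cond (e : Expr k) (c d : Cmd k)
  | loop (e : Expr k) (c : Cmd k)

/-- A machine state: registers, memory, and the output written so far. -/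
structure State (k : ℕ) where
  reg : Fin k → ℕ
  mem : ℕ → ℕ
  out : List ℕ

/-- All registers and memory cells are initially zero. -/
def State.init (k : ℕ) : State k where
  reg := fun _ => 0
  mem := fun _ => 0
  out := []

/-- The number `v`, if it fits into a word. -/
def word (W v : ℕ) : Option ℕ := if v < W then some v else none

/-- The value of an expression; `none` is a fault. -/
def Expr.eval {k : ℕ} (I : Input) (W S : ℕ) (σ : State k) : Expr k → Option ℕ
  | .lit c => word W c
  | .reg r => some (σ.reg r)
  | .textLen => word W I.text.length
  | .patLen => word W I.pat.length
  | .numParams => word W I.numParams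
  | .text i => (i.eval I W S σ).bind fun a => (I.text[a]?).bind (word W)
  | .pat i => (i.eval I W S σ).bind fun a => (I.pat[a]?).bind (word W)
  | .mem i => (i.eval I W S σ).bind fun a => if a < S then some (σ.mem a) else none
  | .bin o a b => (a.eval I W S σ).bind fun x => (b.eval I W S σ).bind fun y => word W (o.eval x y)

/-- The time for evaluating an expression: one step for each operation, access or operand. -/
def Expr.cost {k : ℕ} : Expr k → ℕ
  | .lit _ | .reg _ | .textLen | .patLen | .numParams => 1
  | .text i | .pat i | .mem i => 1 + i.cost
  | .bin _ a b => 1 + a.cost + b.cost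

/-- `Exec I W S c σ t σ'`: on input `I`, with words less than `W` and `S` memory cells, the program `c`
started in state `σ` terminates without a fault after exactly `t` steps, in state `σ'`. -/
inductive Exec {k : ℕ} (I : Input) (W S : ℕ) : Cmd k → State k → ℕ → State k → Prop
  | skip (σ : State k) : Exec I W S .skip σ 1 σ
  | assign {σ : State k} {r : Fin k} {e : Expr k} {v : ℕ} (he : e.eval I W S σ = some v) :
      Exec I W S (.assign r e) σ (1 + e.cost) { σ with reg := Function.update σ.reg r v }
  | store {σ : State k} {i e : Expr k} {a v : ℕ} (hi : i.eval I W S σ = some a) (ha : a < S)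
      (he : e.eval I W S σ = some v) :
      Exec I W S (.store i e) σ (1 + i.cost + e.cost) { σ with mem := Function.update σ.mem a v }
  | output {σ : State k} {e : Expr k} {v : ℕ} (he : e.eval I W S σ = some v) :
      Exec I W S (.output e) σ (1 + e.cost) { σ with out := σ.out ++ [v] }
  | seq {σ σ₁ σ₂ : State k} {c d : Cmd k} {t₁ t₂ : ℕ} (hc : Exec I W S c σ t₁ σ₁)
      (hd : Exec I W S d σ₁ t₂ σ₂) : Exec I W S (.seq c d) σ (t₁ + t₂) σ₂
  | condTrue {σ σ₁ : State k} {e : Expr k} {c d : Cmd k} {v t : ℕ}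
      (he : e.eval I W S σ = some v) (hv : v ≠ 0) (hc : Exec I W S c σ t σ₁) :
      Exec I W S (.cond e c d) σ (1 + e.cost + t) σ₁
  | condFalse {σ σ₁ : State k} {e : Expr k} {c d : Cmd k} {t : ℕ}
      (he : e.eval I W S σ = some 0) (hd : Exec I W S d σ t σ₁) :
      Exec I W S (.cond e c d) σ (1 + e.cost + t) σ₁
  | loopDone {σ : State k} {e : Expr k} {c : Cmd k} (he : e.eval I W S σ = some 0) :
      Exec I W S (.loop e c) σ (1 + e.cost) σ
  | loopStep {σ σ₁ σ₂ : State k} {e : Expr k} {c : Cmd k} {v t₁ t₂ : ℕ}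
      (he : e.eval I W S σ = some v) (hv : v ≠ 0) (hc : Exec I W S c σ t₁ σ₁)
      (hl : Exec I W S (.loop e c) σ₁ t₂ σ₂) :
      Exec I W S (.loop e c) σ (1 + e.cost + t₁ + t₂) σ₂

/-- Machines are deterministic: the running time and the final state are unique. -/
theorem Exec.det {k : ℕ} {I : Input} {W S : ℕ} {c : Cmd k} {σ σ₁ σ₂ : State k} {t₁ t₂ : ℕ}
    (h₁ : Exec I W S c σ t₁ σ₁) (h₂ : Exec I W S c σ t₂ σ₂) : t₁ = t₂ ∧ σ₁ = σ₂ := by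
  induction h₁ generalizing t₂ σ₂ with
  | skip σ => cases h₂; exact ⟨rfl, rfl⟩
  | assign he => cases h₂; simp_all
  | store hi ha he => cases h₂; simp_all
  | output he => cases h₂; simp_all
  | seq hc hd ihc ihd =>
    cases h₂ with
    | seq hc' hd' =>
      obtain ⟨rfl, rfl⟩ := ihc hc'
      obtain ⟨rfl, rfl⟩ := ihd hd'
      exact ⟨rfl, rfl⟩
  | condTrue he hv hc ih =>
    cases h₂ with
    | condTrue he' hv' hc' => obtain ⟨rfl, rfl⟩ := ih hc'; exact ⟨rfl, rfl⟩
    | condFalse he' hc' => simp_all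
  | condFalse he hc ih =>
    cases h₂ with
    | condTrue he' hv' hc' => simp_all
    | condFalse he' hc' => obtain ⟨rfl, rfl⟩ := ih hc'; exact ⟨rfl, rfl⟩
  | loopDone he =>
    cases h₂ with
    | loopDone he' => exact ⟨rfl, rfl⟩
    | loopStep he' hv' hc' hl' => simp_all
  | loopStep he hv hc hl ihc ihl =>
    cases h₂ with
    | loopDone he' => simp_all
    | loopStep he' hv' hc' hl' =>
      obtain ⟨rfl, rfl⟩ := ihc hc'
      obtain ⟨rfl, rfl⟩ := ihl hl'
      exact ⟨rfl, rfl⟩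

end ParamMatch

/-! ### Matching of letter codes and parameterized periods. -/

namespace ParamMatch

/-! The algorithm is a parameterized relative of the Galil–Seiferas matcher. Two strings p-match iff
at each position the letters are equal or both are parameters, and both strings have the same
pattern of equalities (`CodeMatch`, `pMatch_iff_codeMatch`). Whether a match can be extended by one
letter is decided in constant time from the first occurrences of the pattern's parameters and from
stamps on the parameters seen in the current window.

The pattern slides over the pattern followed by the text. A match at a position `i` inside the
pattern is a parameterized period `i` of a prefix, so preprocessing and searching are the same loop.
Suppose that `q` letters match at `i` and no more can be matched. A shift by `d ≤ q` can only
succeed if the prefix of length `q` has period `d`. Let `k = |Π_P| + 4`. If the least period `p` of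
this prefix has `k * p ≤ q`, the shift is `p` and `q - p` matched letters are kept; otherwise it is
`q / k + 1` and the matching restarts from zero letters. In both cases a shift by `s` loses at most
`k * s` matched letters, so a potential linear in `k * i` and `q` bounds the time (`SearchInv`).

The least periods needed are looked up in a table of the periods that are repeated at least `k`
times and reach farther than all smaller ones (`Good`). The table is logarithmic because consecutive
good periods at least double (`Good.two_mul_le`). This follows from a periodicity lemma
(`Per.extend`), in which a pigeonhole argument over the parameters (`Per.exists_lt`) explains the
dependence of `k` on `|Π_P|`. -/

/-- Parameterized matching of the first `q` letters of two sequences of letter codes, where the codes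
less than `K` are the parameters. -/
def CodeMatch (K : ℕ) (x y : ℕ → ℕ) (q : ℕ) : Prop :=
  (∀ t < q, x t = y t ∨ (x t < K ∧ y t < K)) ∧ ∀ s < q, ∀ t < q, (x s = x t ↔ y s = y t)

namespace CodeMatch

variable {K q : ℕ} {x y z : ℕ → ℕ}

theorem zero : CodeMatch K x y 0 := ⟨by simp, by simp⟩

theorem symm (h : CodeMatch K x y q) : CodeMatch K y x q := by
  refine ⟨fun t ht => ?_, fun s hs t ht => (h.2 s hs t ht).symm⟩
  rcases h.1 t ht with h | h
  · exact .inl h.symm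
  · exact .inr h.symm

theorem trans (h : CodeMatch K x y q) (h' : CodeMatch K y z q) : CodeMatch K x z q := by
  refine ⟨fun t ht => ?_, fun s hs t ht => (h.2 s hs t ht).trans (h'.2 s hs t ht)⟩
  have := h.1 t ht
  have := h'.1 t ht
  omega

theorem mono {q' : ℕ} (h : CodeMatch K x y q) (hq : q' ≤ q) : CodeMatch K x y q' :=
  ⟨fun t ht => h.1 t (ht.trans_le hq),
    fun s hs t ht => h.2 s (hs.trans_le hq) t (ht.trans_le hq)⟩

theorem congr {x' y' : ℕ → ℕ} (h : CodeMatch K x y q) (hx : ∀ t < q, x' t = x t)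
    (hy : ∀ t < q, y' t = y t) : CodeMatch K x' y' q := by
  refine ⟨fun t ht => ?_, fun s hs t ht => ?_⟩
  · rw [hx t ht, hy t ht]; exact h.1 t ht
  · rw [hx t ht, hy t ht, hx s hs, hy s hs]; exact h.2 s hs t ht

theorem shift (d : ℕ) (h : CodeMatch K x y (d + q)) :
    CodeMatch K (fun t => x (d + t)) (fun t => y (d + t)) q :=
  ⟨fun t ht => h.1 (d + t) (by omega), fun s hs t ht => h.2 (d + s) (by omega) (d + t) (by omega)⟩

/-- The three `succ` lemmas are the case distinction executed by `compareNext`: the next pattern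
letter is a constant, a parameter seen before, or a new parameter. In the second case a comparison
with one earlier position suffices. -/
theorem succ_of_const (h : CodeMatch K x y q) (hy : K ≤ y q) :
    CodeMatch K x y (q + 1) ↔ x q = y q := by
  refine ⟨fun h' => ?_, fun e => ⟨fun t ht => ?_, fun s hs t ht => ?_⟩⟩
  · have := h'.1 q (by omega); omega
  · rcases Nat.lt_succ_iff_lt_or_eq.1 ht with ht | rfl
    · exact h.1 t ht
    · exact .inl e
  · rcases Nat.lt_succ_iff_lt_or_eq.1 ht with ht | rfl <;>
    rcases Nat.lt_succ_iff_lt_or_eq.1 hs with hs | rfl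
    · exact h.2 s hs t ht
    · have := h.1 t ht; omega
    · have := h.1 s hs; omega
    · simp

theorem succ_of_old (h : CodeMatch K x y q) {j : ℕ} (hj : j < q) (hy : y j = y q) (hK : y q < K) :
    CodeMatch K x y (q + 1) ↔ x q = x j := by
  refine ⟨fun h' => ?_, fun e => ⟨fun t ht => ?_, fun s hs t ht => ?_⟩⟩
  · exact (h'.2 q (by omega) j (by omega)).2 hy.symm
  · rcases Nat.lt_succ_iff_lt_or_eq.1 ht with ht | rfl
    · exact h.1 t ht
    · have := h.1 j hj; omega
  · rcases Nat.lt_succ_iff_lt_or_eq.1 ht with ht | rfl <;>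
    rcases Nat.lt_succ_iff_lt_or_eq.1 hs with hs | rfl
    · exact h.2 s hs t ht
    · rw [e, ← hy]; exact h.2 j hj t ht
    · rw [e, ← hy]; exact h.2 s hs j hj
    · simp

theorem succ_of_new (h : CodeMatch K x y q) (hy : ∀ j < q, y j ≠ y q) (hK : y q < K) :
    CodeMatch K x y (q + 1) ↔ x q < K ∧ ∀ j < q, x j ≠ x q := by
  refine ⟨fun h' => ⟨?_, fun j hj e => hy j hj ?_⟩, fun e => ⟨fun t ht => ?_, fun s hs t ht => ?_⟩⟩
  · have := h'.1 q (by omega); omega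
  · exact (h'.2 j (by omega) q (by omega)).1 e
  · rcases Nat.lt_succ_iff_lt_or_eq.1 ht with ht | rfl
    · exact h.1 t ht
    · exact .inr ⟨e.1, hK⟩
  · rcases Nat.lt_succ_iff_lt_or_eq.1 ht with ht | rfl <;>
    rcases Nat.lt_succ_iff_lt_or_eq.1 hs with hs | rfl
    · exact h.2 s hs t ht
    · exact iff_of_false (fun h => e.2 t ht h.symm) (fun h => hy t ht h.symm)
    · exact iff_of_false (e.2 s hs) (hy s hs)
    · simp

end CodeMatch

/-- The prefix of length `q` of `P` has the parameterized period `p`. -/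
def Per (K : ℕ) (P : ℕ → ℕ) (p q : ℕ) : Prop := CodeMatch K (fun t => P (p + t)) P (q - p)

section Periods

variable {K m : ℕ} {P : ℕ → ℕ}

theorem Per.mono {p q q' : ℕ} (h : Per K P p q) (hq : q' ≤ q) : Per K P p q' :=
  CodeMatch.mono h (by omega)

theorem Per.eq_iff {p q s t : ℕ} (h : Per K P p q) (hs : p + s < q) (ht : p + t < q) :
    P (p + s) = P (p + t) ↔ P s = P t := h.2 s (by omega) t (by omega)

/-- Both occurrences are compared on their overlap in `x`; transitivity matches the shifted prefix
with the prefix itself. -/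
theorem per_of_codeMatch {x : ℕ → ℕ} {d q : ℕ} (h : CodeMatch K x P q)
    (h' : CodeMatch K (fun t => x (d + t)) P (q - d)) : Per K P d q := by
  rcases le_total q d with hd | hd
  -- Without overlap the truncated subtraction makes the period condition empty.
  · unfold Per; rw [Nat.sub_eq_zero_of_le hd]; exact .zero
  · exact ((CodeMatch.shift d (q := q - d) (by rwa [Nat.add_sub_cancel' hd])).symm).trans h'

theorem codeMatch_of_per {x : ℕ → ℕ} {d q : ℕ} (h : CodeMatch K x P q) (h' : Per K P d q)
    (hd : d ≤ q) : CodeMatch K (fun t => x (d + t)) P (q - d) :=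
  (CodeMatch.shift d (q := q - d) (by rwa [Nat.add_sub_cancel' hd])).trans h'

/-- The shift by `q` is the shift by `q - p` followed by the shift by `p`. Undoing the latter costs
`p` letters of length. -/
theorem Per.sub {p q L : ℕ} (hp : Per K P p L) (hq : Per K P q L) (hpq : p ≤ q) (hqL : q ≤ L) :
    Per K P (q - p) (L - p) := by
  have h := CodeMatch.shift (q - p) (q := L - q) (CodeMatch.mono hp (by omega))
  have e : L - p - (q - p) = L - q := by omega
  unfold Per
  rw [e]
  refine h.symm.trans (CodeMatch.congr hq (fun t _ => ?_) fun _ _ => rfl)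
  congr 1; omega

open Classical in
/-- The length of the longest prefix of the first `m` letters that has the parameterized period `p`. -/
noncomputable def reach (K : ℕ) (P : ℕ → ℕ) (m p : ℕ) : ℕ := Nat.findGreatest (Per K P p) m

open Classical in
theorem reach_le (p : ℕ) : reach K P m p ≤ m := Nat.findGreatest_le _

open Classical in
theorem per_reach (p : ℕ) : Per K P p (reach K P m p) :=
  Nat.findGreatest_spec (P := Per K P p) (Nat.zero_le m)
    (by unfold Per; rw [Nat.zero_sub]; exact .zero)

open Classical in
theorem le_reach_iff {p q : ℕ} (hq : q ≤ m) : q ≤ reach K P m p ↔ Per K P p q :=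
  ⟨fun h => (per_reach p).mono h, fun h => Nat.le_findGreatest hq h⟩

theorem reach_eq {p q : ℕ} (hq : q ≤ m) (h : Per K P p q) (h' : q < m → ¬ Per K P p (q + 1)) :
    reach K P m p = q := by
  refine le_antisymm ?_ ((le_reach_iff hq).2 h)
  by_contra! hlt
  have := reach_le (K := K) (P := P) (m := m) p
  exact h' (by omega) ((le_reach_iff (by omega)).1 hlt)

/-- The set of parameters among the first `m` letters. -/
def params (K : ℕ) (P : ℕ → ℕ) (m : ℕ) : Finset ℕ := ((Finset.range m).image P).filter (· < K)

theorem mem_params {a : ℕ} : a ∈ params K P m ↔ (∃ t < m, P t = a) ∧ a < K := by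
  simp [params]

theorem card_params_le : (params K P m).card ≤ K := by
  refine (Finset.card_le_card (t := Finset.range K) fun a ha => ?_).trans_eq (Finset.card_range K)
  simpa using (mem_params.1 ha).2

theorem card_params_le' : (params K P m).card ≤ m :=
  (Finset.card_filter_le _ _).trans (Finset.card_image_le.trans_eq (Finset.card_range m))

theorem Per.eq_add_mul {p L u v : ℕ} (h : Per K P p L) (e : P u = P v) :
    ∀ a : ℕ, u + a * p < L → v + a * p < L → P (u + a * p) = P (v + a * p)
  | 0, _, _ => by simpa using e
  | a + 1, hu, hv => by
    have e1 : u + (a + 1) * p = p + (u + a * p) := by ring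
    have e2 : v + (a + 1) * p = p + (v + a * p) := by ring
    rw [e1] at hu ⊢
    rw [e2] at hv ⊢
    exact (h.eq_iff hu hv).2 (h.eq_add_mul e a (by omega) (by omega))

/-- Going back from `t` in steps of `p`, a constant repeats at once, while a parameter is followed
by parameters only. Among `c + 1` such letters two coincide, and since the period transports
equalities, the coincidence can be moved forward until it involves position `t`. Hence `P t` occurs
earlier, and strong induction applies. -/
theorem Per.exists_lt {p L t : ℕ} (h : Per K P p L) (hp : 0 < p) (hL : L ≤ m) (ht : t < L) :
    ∃ t' < ((params K P m).card + 1) * p, P t' = P t := by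
  set c := (params K P m).card with hc
  induction t using Nat.strong_induction_on with
  | _ t ih =>
    by_cases hlt : t < (c + 1) * p
    · exact ⟨t, hlt, rfl⟩
    push Not at hlt
    have hmul : ∀ a ≤ c + 1, a * p ≤ t := fun a ha => (Nat.mul_le_mul_right p ha).trans hlt
    suffices ∃ d, 0 < d ∧ d ≤ t ∧ P (t - d) = P t by
      obtain ⟨d, hd, hdt, e⟩ := this
      obtain ⟨t', ht', e'⟩ := ih (t - d) (by omega) (by omega)
      exact ⟨t', ht', e'.trans e⟩
    have hback : ∀ u < L, p ≤ u → P u = P (u - p) ∨ (P u < K ∧ P (u - p) < K) := fun u hu hpu => by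
      have := h.1 (u - p) (by omega)
      simpa [Nat.add_sub_cancel' hpu] using this
    rcases le_or_gt K (P t) with hK | hK
    · have h1 := hmul 1 (by omega)
      rw [one_mul] at h1
      refine ⟨p, hp, h1, ?_⟩
      have := hback t ht h1
      omega
    have hpar : ∀ a ≤ c, P (t - a * p) < K := by
      intro a
      induction a with
      | zero => intro _; simpa using hK
      | succ a iha =>
        intro ha
        have h1 := iha (by omega)
        have h2 := hmul (a + 1) (by omega)
        rw [Nat.succ_mul] at h2
        have h3 := hback (t - a * p) (by omega) (by omega)
        rw [Nat.sub_sub, ← Nat.succ_mul] at h3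
        change _ ∨ (_ ∧ P (t - (a + 1) * p) < K) at h3
        rcases h3 with h3 | h3
        · exact h3 ▸ h1
        · exact h3.2
    obtain ⟨a, ha, b, hb, hab, e⟩ := Finset.exists_ne_map_eq_of_card_lt_of_maps_to
      (s := Finset.range (c + 1)) (t := params K P m) (f := fun a => P (t - a * p))
      (by simp [hc]) (fun a ha => by
        simp only [Finset.coe_range, Set.mem_Iio] at ha
        exact Finset.mem_coe.2 (mem_params.2 ⟨⟨t - a * p, by omega, rfl⟩, hpar a (by omega)⟩))
    simp only [Finset.mem_range] at ha hb
    have key : ∀ a b : ℕ, a < b → b < c + 1 → P (t - a * p) = P (t - b * p) →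
        ∃ d, 0 < d ∧ d ≤ t ∧ P (t - d) = P t := by
      intro a b hab hb e
      have h1 := hmul b (by omega)
      have h2 : a * p + (b - a) * p = b * p := by rw [← Nat.add_mul]; congr 1; omega
      have h3 : 0 < (b - a) * p := Nat.mul_pos (by omega) hp
      have h4 := h.eq_add_mul e a (by omega) (by omega)
      refine ⟨(b - a) * p, h3, by omega, ?_⟩
      rw [show t - a * p + a * p = t by omega, show t - b * p + a * p = t - (b - a) * p by omega] at h4
      exact h4.symm
    rcases lt_or_gt_of_ne hab with hab | hab
    · exact key a b hab hb e
    · exact key b a hab ha e.symm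

/-- A short period of a sufficiently long prefix extends along a longer period. -/
theorem Per.extend {p g L r : ℕ} (hp : Per K P p r) (hg : Per K P g L) (hp0 : 0 < p) (hLr : L ≤ r)
    (hr : r ≤ m) (hL : ((params K P m).card + 2) * p + g ≤ L) : Per K P g r := by
  set c := (params K P m).card with hc
  have e1 : (c + 2) * p = (c + 1) * p + p := by ring
  have base : ∀ t, t + g < L → ∃ t' < (c + 1) * p, P t' = P t ∧ P (g + t') = P (g + t) := by
    intro t ht
    obtain ⟨t', ht', e⟩ := (hp.mono hLr).exists_lt hp0 (hLr.trans hr) (t := t) (by omega)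
    rw [← hc] at ht'
    exact ⟨t', ht', e, (hg.eq_iff (by omega) (by omega)).2 e⟩
  -- The pair of letters at `t` and `g + t` is determined by the pair at `t - p` and `g + t - p`
  -- through the period `p`. If `u` represents `t - p`, then `p + u < (c + 2) * p` is still in the
  -- range of `base`; this is the origin of `c + 2`. So all pairs occur where `g` is known to be a
  -- period.
  have all : ∀ t, t + g < r → ∃ t' < (c + 1) * p, P t' = P t ∧ P (g + t') = P (g + t) := by
    intro t
    induction t using Nat.strong_induction_on with
    | _ t ih =>
      intro ht
      by_cases hlt : t + g < L
      · exact base t hlt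
      obtain ⟨u, hu, e, e'⟩ := ih (t - p) (by omega) (by omega)
      obtain ⟨t', ht', f, f'⟩ := base (p + u) (by omega)
      refine ⟨t', ht', f.trans ?_, f'.trans ?_⟩
      · have := (hp.eq_iff (s := u) (t := t - p) (by omega) (by omega)).2 e
        rwa [show p + (t - p) = t by omega] at this
      · have := (hp.eq_iff (s := g + u) (t := g + (t - p)) (by omega) (by omega)).2 e'
        rwa [show p + (g + (t - p)) = g + t by omega, show p + (g + u) = g + (p + u) by ring] at this
  refine ⟨fun t ht => ?_, fun s hs t ht => ?_⟩
  · obtain ⟨t', ht', e, e'⟩ := all t (by omega)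
    have : P (g + t') = P t' ∨ P (g + t') < K ∧ P t' < K := hg.1 t' (by omega)
    change P (g + t) = P t ∨ P (g + t) < K ∧ P t < K
    rwa [e, e'] at this
  · obtain ⟨t', ht', e, e'⟩ := all t (by omega)
    obtain ⟨s', hs', f, f'⟩ := all s (by omega)
    have : P (g + s') = P (g + t') ↔ P s' = P t' := hg.2 s' (by omega) t' (by omega)
    change P (g + s) = P (g + t) ↔ P s = P t
    rwa [e, e', f, f'] at this

/-- A period that is repeated often in its reach and reaches farther than all smaller ones. -/
structure Good (K : ℕ) (P : ℕ → ℕ) (m p : ℕ) : Prop where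
  pos : 0 < p
  le : ((params K P m).card + 4) * p ≤ reach K P m p
  lt : ∀ p', 0 < p' → p' < p → reach K P m p' < reach K P m p

theorem Good.lt_length {p : ℕ} (h : Good K P m p) : p < m := by
  have h1 := h.le
  have h2 := h.pos
  have h3 := reach_le (K := K) (P := P) (m := m) p
  have h4 : 4 * p ≤ ((params K P m).card + 4) * p := Nat.mul_le_mul_right p (by omega)
  omega

/-- If `p₂ < 2 * p₁`, the difference `p₂ - p₁` is a period of all but `p₁` letters of the reach of
`p₁`. By `Per.extend` it has the whole reach, although it is smaller than `p₁`. The factor `c + 4`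
leaves just enough room for this. -/
theorem Good.two_mul_le {p₁ p₂ : ℕ} (h : Good K P m p₁) (hlt : p₁ < p₂)
    (h₂ : Per K P p₂ (reach K P m p₁)) : 2 * p₁ ≤ p₂ := by
  by_contra! hlt'
  have h0 := h.pos
  have h1 := h.le
  have h2 := reach_le (K := K) (P := P) (m := m) p₁
  have e : ((params K P m).card + 4) * p₁ = ((params K P m).card + 2) * p₁ + 2 * p₁ := by ring
  have hd : Per K P (p₂ - p₁) (reach K P m p₁ - p₁) := (per_reach p₁).sub h₂ hlt.le (by omega)
  have hd' : Per K P (p₂ - p₁) (reach K P m p₁) :=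
    (per_reach p₁).extend hd h0 (by omega) h2 (by omega)
  have h3 := h.lt (p₂ - p₁) (by omega) (by omega)
  exact absurd ((le_reach_iff h2).2 hd') (by omega)

/-- The least period of the prefix of length `q` is good: no smaller one reaches `q`. -/
theorem exists_good {p₀ q : ℕ} (hp₀ : 0 < p₀) (hq : q ≤ m) (h : Per K P p₀ q)
    (hle : ((params K P m).card + 4) * p₀ ≤ q) :
    ∃ p ≤ p₀, Good K P m p ∧ q ≤ reach K P m p ∧ ∀ p', 0 < p' → p' < p → ¬ Per K P p' q := by
  classical
  have hex : ∃ p, 0 < p ∧ Per K P p q := ⟨p₀, hp₀, h⟩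
  obtain ⟨hpos, hper⟩ := Nat.find_spec hex
  have hmin : ∀ p', 0 < p' → p' < Nat.find hex → ¬ Per K P p' q :=
    fun p' h0 hlt hp => Nat.find_min hex hlt ⟨h0, hp⟩
  have hle₀ : Nat.find hex ≤ p₀ := Nat.find_min' hex ⟨hp₀, h⟩
  have hr := (le_reach_iff hq).2 hper
  refine ⟨Nat.find hex, hle₀, ⟨hpos, ?_, fun p' h0 hlt => ?_⟩, hr, hmin⟩
  · exact ((Nat.mul_le_mul_left _ hle₀).trans hle).trans hr
  · have := mt (le_reach_iff hq).1 (hmin p' h0 hlt)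
    omega

end Periods

end ParamMatch

/-! ### Program logic for total correctness and running time. -/

namespace ParamMatch

section Logic

variable {k : ℕ} {I : Input} {W S : ℕ}

/-- The state after assigning `v` to register `r`. -/
def State.set (σ : State k) (r : Fin k) (v : ℕ) : State k :=
  { σ with reg := Function.update σ.reg r v }

/-- The state after storing `v` in memory cell `a`. -/
def State.put (σ : State k) (a v : ℕ) : State k := { σ with mem := Function.update σ.mem a v }

/-- The state after writing `v` to the output. -/
def State.push (σ : State k) (v : ℕ) : State k := { σ with out := σ.out ++ [v] }

@[simp] theorem State.set_reg (σ : State k) (r r' : Fin k) (v : ℕ) :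
    (σ.set r v).reg r' = if r' = r then v else σ.reg r' := by
  simp [State.set, Function.update_apply]
@[simp] theorem State.set_mem (σ : State k) (r : Fin k) (v : ℕ) : (σ.set r v).mem = σ.mem := rfl
@[simp] theorem State.set_out (σ : State k) (r : Fin k) (v : ℕ) : (σ.set r v).out = σ.out := rfl
@[simp] theorem State.put_reg (σ : State k) (a v : ℕ) : (σ.put a v).reg = σ.reg := rfl
@[simp] theorem State.put_mem (σ : State k) (a v : ℕ) :
    (σ.put a v).mem = Function.update σ.mem a v := rfl
@[simp] theorem State.put_out (σ : State k) (a v : ℕ) : (σ.put a v).out = σ.out := rfl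

theorem word_of_lt {v : ℕ} (h : v < W) : word W v = some v := if_pos h

theorem word_ite (h : 1 < W) (p : Prop) [Decidable p] :
    word W (if p then 1 else 0) = some (if p then 1 else 0) :=
  word_of_lt (by split <;> omega)

/-- Started in state `σ`, the program `c` terminates without a fault, and its running time and final
state satisfy `Q`. -/
def Terminates (I : Input) (W S : ℕ) (c : Cmd k) (σ : State k) (Q : ℕ → State k → Prop) : Prop :=
  ∃ t σ', Exec I W S c σ t σ' ∧ Q t σ'

namespace Terminates

variable {σ : State k} {c d : Cmd k} {e : Expr k} {Q Q' : ℕ → State k → Prop}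

theorem imp (h : Terminates I W S c σ Q) (hQ : ∀ t σ', Q t σ' → Q' t σ') :
    Terminates I W S c σ Q' := by
  obtain ⟨t, σ', he, hq⟩ := h
  exact ⟨t, σ', he, hQ _ _ hq⟩

theorem skip (h : Q 1 σ) : Terminates I W S .skip σ Q := ⟨_, _, .skip σ, h⟩

theorem assign {r : Fin k} {v : ℕ} (he : e.eval I W S σ = some v) (h : Q (1 + e.cost) (σ.set r v)) :
    Terminates I W S (.assign r e) σ Q := ⟨_, _, .assign he, h⟩

theorem store {i : Expr k} {a v : ℕ} (hi : i.eval I W S σ = some a) (ha : a < S)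
    (he : e.eval I W S σ = some v) (h : Q (1 + i.cost + e.cost) (σ.put a v)) :
    Terminates I W S (.store i e) σ Q := ⟨_, _, .store hi ha he, h⟩

theorem output {v : ℕ} (he : e.eval I W S σ = some v) (h : Q (1 + e.cost) (σ.push v)) :
    Terminates I W S (.output e) σ Q := ⟨_, _, .output he, h⟩

theorem seq (h : Terminates I W S c σ fun t σ₁ => Terminates I W S d σ₁ fun t' σ₂ => Q (t + t') σ₂) :
    Terminates I W S (.seq c d) σ Q := by
  obtain ⟨t, σ₁, h₁, t', σ₂, h₂, hq⟩ := h
  exact ⟨_, _, .seq h₁ h₂, hq⟩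

theorem cond {p : Prop} [Decidable p] (he : e.eval I W S σ = some (if p then 1 else 0))
    (hc : p → Terminates I W S c σ fun t σ' => Q (1 + e.cost + t) σ')
    (hd : ¬ p → Terminates I W S d σ fun t σ' => Q (1 + e.cost + t) σ') :
    Terminates I W S (.cond e c d) σ Q := by
  by_cases hp : p
  · obtain ⟨t, σ₁, h₁, hq⟩ := hc hp
    rw [if_pos hp] at he
    exact ⟨_, _, .condTrue he one_ne_zero h₁, hq⟩
  · obtain ⟨t, σ₁, h₁, hq⟩ := hd hp
    rw [if_neg hp] at he
    exact ⟨_, _, .condFalse he h₁, hq⟩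

/-- The loop rule. The invariant refers to the time `t` spent so far and has to bound it by `B`. -/
theorem loop (Inv : ℕ → State k → Prop) (B : ℕ) (hB : ∀ t σ, Inv t σ → t ≤ B)
    (p : State k → Prop) [∀ σ, Decidable (p σ)]
    (he : ∀ t σ, Inv t σ → e.eval I W S σ = some (if p σ then 1 else 0))
    (hstep : ∀ t σ, Inv t σ → p σ →
      Terminates I W S c σ fun t' σ' => Inv (t + (1 + e.cost + t')) σ')
    (hdone : ∀ t σ, Inv t σ → ¬ p σ → Q (t + (1 + e.cost)) σ)
    (h0 : Inv 0 σ) : Terminates I W S (.loop e c) σ Q := by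
  -- Induction on the remaining budget `B - t`: each iteration costs at least one step, so the time
  -- bound also proves termination.
  have key : ∀ b t σ, Inv t σ → B - t ≤ b →
      Terminates I W S (.loop e c) σ fun t' σ' => Q (t + t') σ' := by
    intro b
    induction b with
    | zero =>
      intro t σ hi hb
      by_cases hp : p σ
      · obtain ⟨t', σ', _, hi'⟩ := hstep t σ hi hp
        have := hB _ _ hi'
        have := hB _ _ hi
        omega
      · exact ⟨_, _, .loopDone ((he t σ hi).trans (by rw [if_neg hp])), hdone t σ hi hp⟩
    | succ b ih =>
      intro t σ hi hb
      by_cases hp : p σ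
      · obtain ⟨t', σ', hx, hi'⟩ := hstep t σ hi hp
        obtain ⟨t'', σ'', hx', hq⟩ := ih _ _ hi' (by omega)
        refine ⟨_, _, .loopStep ((he t σ hi).trans (by rw [if_pos hp])) one_ne_zero hx hx', ?_⟩
        simpa only [Nat.add_assoc] using hq
      · exact ⟨_, _, .loopDone ((he t σ hi).trans (by rw [if_neg hp])), hdone t σ hi hp⟩
  simpa using key _ 0 σ h0 le_rfl

end Terminates

end Logic

end ParamMatch

/-! ### Admissible inputs and the tables of first occurrences. -/

namespace ParamMatch

section Pass

/-- The code of the letter of the pattern at position `t`. -/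
def Input.patAt (I : Input) (t : ℕ) : ℕ := I.pat.getD t 0

/-- The code of the letter at position `t` of the pattern followed by the text. -/
def Input.virt (I : Input) (t : ℕ) : ℕ := (I.pat ++ I.text).getD t 0

/-- The number of parameters of the pattern. -/
def Input.card (I : Input) : ℕ := (params I.numParams I.patAt I.pat.length).card

/-- Words and memory are large enough. -/
structure Admissible (I : Input) (W S : ℕ) : Prop where
  -- The square makes room for the product `(I.card + 4) * i` computed in `record`.
  word : 64 * (I.text.length + I.pat.length + I.numParams + 2) ^ 2 ≤ W
  pat_lt : ∀ a ∈ I.pat, a < W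
  text_lt : ∀ a ∈ I.text, a < W
  -- With `K` parameters, the three blocks of `K` cells hold first positions, stamps and the list of
  -- first positions. The pairs of the period table follow; the bound on the cells must include the
  -- pair with index `cnt`, where `cnt ≤ log m + 1`.
  space : 3 * I.numParams + 2 * Nat.log 2 I.pat.length + 4 ≤ S

variable {I : Input} {W S : ℕ}

theorem Input.virt_of_lt {t : ℕ} (h : t < I.pat.length) : I.virt t = I.patAt t :=
  List.getD_append _ _ _ _ h

theorem Input.virt_add (t : ℕ) : I.virt (I.pat.length + t) = I.text.getD t 0 := by
  unfold Input.virt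
  rw [List.getD_append_right _ _ _ _ (by omega), Nat.add_sub_cancel_left]

namespace Admissible

theorem linear (h : Admissible I W S) :
    128 * (I.text.length + I.pat.length + I.numParams + 2) ≤ W := by
  have := h.word
  nlinarith

theorem virt_lt (h : Admissible I W S) (t : ℕ) : I.virt t < W := by
  have h0 := h.linear
  have : ∀ a ∈ I.pat ++ I.text, a < W := by
    simp only [List.mem_append]
    rintro a (ha | ha)
    exacts [h.pat_lt a ha, h.text_lt a ha]
  by_cases ht : t < (I.pat ++ I.text).length
  · unfold Input.virt
    rw [List.getD_eq_getElem _ _ ht]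
    exact this _ (List.getElem_mem ht)
  · unfold Input.virt
    rw [List.getD_eq_default _ _ (not_lt.1 ht)]
    omega

theorem eval_pat (h : Admissible I W S) {t : ℕ} (ht : t < I.pat.length) :
    (I.pat[t]?).bind (ParamMatch.word W) = some (I.patAt t) := by
  have h1 := h.virt_lt t
  rw [Input.virt_of_lt ht] at h1
  rw [← word_of_lt h1, Input.patAt, List.getD_eq_getElem _ _ ht, List.getElem?_eq_getElem ht]
  rfl

theorem eval_text (h : Admissible I W S) {t : ℕ} (ht : t < I.text.length) :
    (I.text[t]?).bind (ParamMatch.word W) = some (I.virt (I.pat.length + t)) := by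
  have h1 := h.virt_lt (I.pat.length + t)
  rw [← word_of_lt h1, Input.virt_add, List.getD_eq_getElem _ _ ht, List.getElem?_eq_getElem ht]
  rfl

end Admissible

open ParamMatch.Expr ParamMatch.Cmd ParamMatch.Op

/-- Read the letter at position `e` of the pattern followed by the text. -/
def readAt (dst : Fin 10) (e : Expr 10) : Cmd 10 :=
  cond (bin lt e patLen) (assign dst (pat e)) (assign dst (text (bin sub e patLen)))

theorem readAt_terminates (h : Admissible I W S) {dst : Fin 10} {e : Expr 10} {σ : State 10} {x : ℕ}
    {Q : ℕ → State 10 → Prop} (he : e.eval I W S σ = some x)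
    (hx : x < I.pat.length + I.text.length)
    (hQ : ∀ t ≤ 7 + 2 * e.cost, Q t (σ.set dst (I.virt x))) :
    Terminates I W S (readAt dst e) σ Q := by
  have hl := h.linear
  refine .cond (p := x < I.pat.length) ?_ (fun hp => ?_) fun hp => ?_
  · simp (disch := omega) [Expr.eval, he, Op.eval, word_of_lt, word_ite]
  · refine .assign (v := I.patAt x) ?_ ?_
    · simp [Expr.eval, he, h.eval_pat hp]
    · rw [← Input.virt_of_lt hp]
      exact hQ _ (by simp [Expr.cost]; omega)
  · refine .assign (v := I.virt x) ?_ ?_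
    · have := h.eval_text (t := x - I.pat.length) (by omega)
      rw [Nat.add_sub_cancel' (by omega)] at this
      have hn : I.pat.length < W := by omega
      have hx' : x - I.pat.length < W := by omega
      simpa only [Expr.eval, he, Option.bind_some, Op.eval, word_of_lt hn, word_of_lt hx'] using this
    · exact hQ _ (by simp [Expr.cost]; omega)

/-- The tables of first occurrences for the first `x` letters of the pattern: cell `a < K` holds the
first position of parameter `a` plus one, and these positions are listed from cell `2 * K` on. -/
structure Tables (K : ℕ) (P : ℕ → ℕ) (x : ℕ) (mem : ℕ → ℕ) : Prop where
  first : ∀ t < x, P t < K → ∃ j ≤ t, mem (P t) = j + 1 ∧ P j = P t ∧ ∀ s < j, P s ≠ P t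
  seen : ∀ a < K, mem a ≠ 0 → ∃ t < x, P t = a
  list : ∀ t < x, P t < K → ∃ l < (params K P x).card, mem (2 * K + l) ≤ t ∧ P (mem (2 * K + l)) = P t
  list_lt : ∀ l < (params K P x).card, mem (2 * K + l) < x ∧ P (mem (2 * K + l)) < K

theorem params_succ (K : ℕ) (P : ℕ → ℕ) (x : ℕ) :
    params K P (x + 1) = if P x < K then insert (P x) (params K P x) else params K P x := by
  simp [params, Finset.range_add_one, Finset.image_insert, Finset.filter_insert]

namespace Tables

variable {K x : ℕ} {P mem mem' : ℕ → ℕ}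

theorem congr (h : Tables K P x mem) (h1 : ∀ a < K, mem' a = mem a)
    (h2 : ∀ l < K, mem' (2 * K + l) = mem (2 * K + l)) : Tables K P x mem' := by
  have hc := card_params_le (K := K) (P := P) (m := x)
  refine ⟨fun t ht hK => ?_, fun a ha => ?_, fun t ht hK => ?_, fun l hl => ?_⟩
  · rw [h1 _ hK]; exact h.first t ht hK
  · rw [h1 _ ha]; exact h.seen a ha
  · obtain ⟨l, hl, hh⟩ := h.list t ht hK
    exact ⟨l, hl, by rwa [h2 _ (hl.trans_le hc)]⟩
  · rw [h2 _ (hl.trans_le hc)]; exact h.list_lt l hl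

theorem zero (h : ∀ a, mem a = 0) : Tables K P 0 mem :=
  ⟨by simp, fun a _ ha => absurd (h a) ha, by simp, by simp [params]⟩

theorem const (h : Tables K P x mem) (hx : K ≤ P x) :
    Tables K P (x + 1) mem ∧ params K P (x + 1) = params K P x := by
  have hp : params K P (x + 1) = params K P x := by rw [params_succ, if_neg (by omega)]
  have hlt : ∀ t < x + 1, P t < K → t < x := by
    intro t ht hK
    rcases Nat.lt_succ_iff_lt_or_eq.1 ht with ht | rfl
    · exact ht
    · omega
  refine ⟨⟨fun t ht hK => h.first t (hlt t ht hK) hK, fun a ha h0 => ?_,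
    fun t ht hK => hp ▸ h.list t (hlt t ht hK) hK, fun l hl => ?_⟩, hp⟩
  · obtain ⟨t, ht, e⟩ := h.seen a ha h0
    exact ⟨t, by omega, e⟩
  · have := h.list_lt l (hp ▸ hl)
    exact ⟨by omega, this.2⟩

theorem old (h : Tables K P x mem) (hx : P x < K) (h0 : mem (P x) ≠ 0) :
    Tables K P (x + 1) mem ∧ params K P (x + 1) = params K P x := by
  obtain ⟨u, hu, e⟩ := h.seen _ hx h0
  have hp : params K P (x + 1) = params K P x := by
    rw [params_succ, if_pos hx]
    exact Finset.insert_eq_of_mem (mem_params.2 ⟨⟨u, hu, e⟩, hx⟩)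
  refine ⟨⟨fun t ht hK => ?_, fun a ha h0 => ?_, fun t ht hK => ?_, fun l hl => ?_⟩, hp⟩
  · rcases Nat.lt_succ_iff_lt_or_eq.1 ht with ht | rfl
    · exact h.first t ht hK
    · obtain ⟨j, hj, hh⟩ := h.first u hu (e ▸ hx)
      rw [e] at hh
      exact ⟨j, by omega, hh⟩
  · obtain ⟨t, ht, e⟩ := h.seen a ha h0
    exact ⟨t, by omega, e⟩
  · rw [hp]
    rcases Nat.lt_succ_iff_lt_or_eq.1 ht with ht | rfl
    · exact h.list t ht hK
    · obtain ⟨l, hl, hh, hh'⟩ := h.list u hu (e ▸ hx)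
      exact ⟨l, hl, by omega, hh'.trans e⟩
  · have := h.list_lt l (hp ▸ hl)
    exact ⟨by omega, this.2⟩

theorem new (h : Tables K P x mem) (hx : P x < K) (h0 : mem (P x) = 0) :
    Tables K P (x + 1) (Function.update (Function.update mem (P x) (x + 1))
      (2 * K + (params K P x).card) x) ∧
    (params K P (x + 1)).card = (params K P x).card + 1 := by
  have hno : ∀ s < x, P s ≠ P x := by
    intro s hs e
    obtain ⟨j, _, hj, _⟩ := h.first s hs (e ▸ hx)
    rw [e] at hj
    omega
  have hp : (params K P (x + 1)).card = (params K P x).card + 1 := by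
    rw [params_succ, if_pos hx]
    refine Finset.card_insert_of_notMem fun hm => ?_
    obtain ⟨⟨t, ht, e⟩, _⟩ := mem_params.1 hm
    exact hno t ht e
  set c := (params K P x).card with hc
  have e1 : ∀ a < K, a ≠ P x →
      Function.update (Function.update mem (P x) (x + 1)) (2 * K + c) x a = mem a := by
    intro a ha hne
    rw [Function.update_of_ne (by omega), Function.update_of_ne hne]
  have e2 : Function.update (Function.update mem (P x) (x + 1)) (2 * K + c) x (P x) = x + 1 := by
    rw [Function.update_of_ne (by omega), Function.update_self]
  have e3 : ∀ l < c, Function.update (Function.update mem (P x) (x + 1)) (2 * K + c) x (2 * K + l)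
      = mem (2 * K + l) := by
    intro l hl
    rw [Function.update_of_ne (by omega), Function.update_of_ne (by omega)]
  have e4 : Function.update (Function.update mem (P x) (x + 1)) (2 * K + c) x (2 * K + c) = x :=
    Function.update_self ..
  refine ⟨⟨fun t ht hK => ?_, fun a ha h0 => ?_, fun t ht hK => ?_, fun l hl => ?_⟩, hp⟩
  · rcases Nat.lt_succ_iff_lt_or_eq.1 ht with ht | rfl
    · rw [e1 _ hK (hno t ht)]
      exact h.first t ht hK
    · exact ⟨t, le_rfl, e2, rfl, hno⟩
  · by_cases ha' : a = P x
    · exact ⟨x, by omega, ha'.symm⟩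
    · rw [e1 _ ha ha'] at h0
      obtain ⟨t, ht, e⟩ := h.seen a ha h0
      exact ⟨t, by omega, e⟩
  · rw [hp]
    rcases Nat.lt_succ_iff_lt_or_eq.1 ht with ht | rfl
    · obtain ⟨l, hl, hh⟩ := h.list t ht hK
      exact ⟨l, by omega, by rwa [e3 l hl]⟩
    · exact ⟨c, by omega, by rw [e4], by rw [e4]⟩
  · rw [hp] at hl
    rcases Nat.lt_succ_iff_lt_or_eq.1 hl with hl | rfl
    · rw [e3 l hl]
      have := h.list_lt l hl
      exact ⟨by omega, this.2⟩
    · rw [e4]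
      exact ⟨by omega, hx⟩

end Tables

/-- Compute the tables of first occurrences and the number of parameters of the pattern. -/
def firstPass : Cmd 10 :=
  loop (bin lt (reg 0) patLen)
    (seq (assign 6 (pat (reg 0)))
      (seq
        (cond (bin lt (reg 6) numParams)
          (cond (bin eq (mem (reg 6)) (lit 0))
            -- Storing the position plus one lets the initial value `0` mean that the parameter has
            -- not been seen.
            (seq (store (reg 6) (bin add (reg 0) (lit 1)))
              (seq (store (bin add (bin add numParams numParams) (reg 1)) (reg 0))
                (assign 1 (bin add (reg 1) (lit 1)))))
            skip)
          skip)
        (assign 0 (bin add (reg 0) (lit 1)))))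

/-- The invariant of the first pass. -/
structure FirstInv (I : Input) (t : ℕ) (σ : State 10) : Prop where
  time : t ≤ 40 * σ.reg 0
  le : σ.reg 0 ≤ I.pat.length
  card : σ.reg 1 = (params I.numParams I.patAt (σ.reg 0)).card
  tables : Tables I.numParams I.patAt (σ.reg 0) σ.mem
  stamps : ∀ a < I.numParams, σ.mem (I.numParams + a) = 0
  q : σ.reg 3 = 0
  cnt : σ.reg 4 = 0
  rlast : σ.reg 8 = 0
  out : σ.out = []

theorem firstPass_terminates (h : Admissible I W S) :
    Terminates I W S firstPass (.init 10) fun t σ =>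
      FirstInv I 0 σ ∧ σ.reg 0 = I.pat.length ∧ t ≤ 40 * I.pat.length + 4 := by
  have hl := h.linear
  have hs := h.space
  refine .loop (FirstInv I) (40 * I.pat.length) (fun t σ hi => ?_) (fun σ => σ.reg 0 < I.pat.length)
    (fun t σ hi => ?_) (fun t σ hi hlt => ?_) (fun t σ hi hge => ?_) ?_
  · have := hi.time; have := hi.le; omega
  · simp (disch := omega) [Expr.eval, Op.eval, word_of_lt, word_ite]
  · have htime := hi.time
    have hcard := hi.card
    have hcK := card_params_le (K := I.numParams) (P := I.patAt) (m := σ.reg 0)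
    have hstamps := hi.stamps
    refine .seq (.assign (v := I.patAt (σ.reg 0)) ?_ (.seq ?_))
    · simp [Expr.eval, h.eval_pat hlt]
    refine .cond (p := I.patAt (σ.reg 0) < I.numParams) ?_ (fun hp => ?_) fun hp => ?_
    · simp (disch := omega) [Expr.eval, Op.eval, word_of_lt, word_ite]
    · refine .cond (p := σ.mem (I.patAt (σ.reg 0)) = 0) ?_ (fun hz => ?_) fun hz => ?_
      · have : I.patAt (σ.reg 0) < S := by omega
        simp (disch := omega) [Expr.eval, Op.eval, word_of_lt, word_ite, this]
      · obtain ⟨hT, hc⟩ := hi.tables.new hp hz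
        have hcK' := card_params_le (K := I.numParams) (P := I.patAt) (m := σ.reg 0 + 1)
        refine .seq (.store (a := I.patAt (σ.reg 0)) (v := σ.reg 0 + 1) ?_ (by omega) ?_
          (.seq (.store (a := 2 * I.numParams + σ.reg 1) (v := σ.reg 0) ?_ (by omega) ?_
            (.assign (v := σ.reg 1 + 1) ?_ (.assign (v := σ.reg 0 + 1) ?_ ?_)))))
        · simp [Expr.eval]
        · simp (disch := omega) [Expr.eval, Op.eval, word_of_lt]
        · simp (disch := omega) [Expr.eval, Op.eval, word_of_lt, two_mul]
        · simp [Expr.eval]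
        · simp (disch := omega) [Expr.eval, Op.eval, word_of_lt]
        · simp (disch := omega) [Expr.eval, Op.eval, word_of_lt]
        · refine ⟨?_, ?_, ?_, ?_, fun a ha => ?_, ?_, ?_, ?_, ?_⟩
          · simp [Expr.cost]; omega
          · simp; omega
          · simp [hc, hcard]
          · simpa [hcard] using hT
          · simp only [State.set_mem, State.put_mem]
            rw [Function.update_of_ne (by omega), Function.update_of_ne (by omega), hstamps a ha]
          · simp [hi.q]
          · simp [hi.cnt]
          · simp [hi.rlast]
          · simp [hi.out]
      · obtain ⟨hT, hc⟩ := hi.tables.old hp hz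
        refine .skip (.assign (v := σ.reg 0 + 1) ?_ ?_)
        · simp (disch := omega) [Expr.eval, Op.eval, word_of_lt]
        · refine ⟨?_, ?_, ?_, ?_, fun a ha => ?_, ?_, ?_, ?_, ?_⟩
          · simp [Expr.cost]; omega
          · simp; omega
          · simp [hc, hcard]
          · simpa using hT
          · exact hstamps a ha
          · simp [hi.q]
          · simp [hi.cnt]
          · simp [hi.rlast]
          · simp [hi.out]
    · obtain ⟨hT, hc⟩ := hi.tables.const (not_lt.1 hp)
      refine .skip (.assign (v := σ.reg 0 + 1) ?_ ?_)
      · simp (disch := omega) [Expr.eval, Op.eval, word_of_lt]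
      · refine ⟨?_, ?_, ?_, ?_, fun a ha => ?_, ?_, ?_, ?_, ?_⟩
        · simp [Expr.cost]; omega
        · simp; omega
        · simp [hc, hcard]
        · simpa using hT
        · exact hstamps a ha
        · simp [hi.q]
        · simp [hi.cnt]
        · simp [hi.rlast]
        · simp [hi.out]
  · have := hi.le
    have := hi.time
    exact ⟨⟨by omega, hi.le, hi.card, hi.tables, hi.stamps, hi.q, hi.cnt, hi.rlast, hi.out⟩, by omega,
      by simp [Expr.cost]; omega⟩
  · exact ⟨by simp, by simp [State.init], by simp [State.init, params],
      .zero fun _ => rfl, fun _ _ => rfl, rfl, rfl, rfl, rfl⟩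

end Pass

end ParamMatch

/-! ### Invariants of the search and their preservation. -/

namespace ParamMatch

section Invariants

variable {I : Input} {i q b cnt rl : ℕ} {mem mem' : ℕ → ℕ} {out : List ℕ}

/-- `q` letters of the pattern match at position `i` of the pattern followed by the text. -/
def Input.Matches (I : Input) (i q : ℕ) : Prop :=
  CodeMatch I.numParams (fun t => I.virt (i + t)) I.patAt q

/-- `Per` for the pattern of the input. -/
abbrev Input.Per (I : Input) (p q : ℕ) : Prop := ParamMatch.Per I.numParams I.patAt p q

/-- `reach` for the pattern of the input. -/
noncomputable abbrev Input.reach (I : Input) (p : ℕ) : ℕ :=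
  ParamMatch.reach I.numParams I.patAt I.pat.length p

/-- `Good` for the pattern of the input. -/
abbrev Input.Good (I : Input) (p : ℕ) : Prop := ParamMatch.Good I.numParams I.patAt I.pat.length p

/-- Inside the pattern, the pattern is matched against itself. This lets a single loop find both
periods and occurrences. -/
theorem Input.matches_iff_per (h : i + q ≤ I.pat.length) : I.Matches i q ↔ I.Per i (i + q) := by
  have e : ∀ t < q, I.patAt (i + t) = I.virt (i + t) := fun t ht =>
    (Input.virt_of_lt (by omega)).symm
  unfold Input.Matches Input.Per ParamMatch.Per
  rw [Nat.add_sub_cancel_left]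
  exact ⟨fun h' => h'.congr e fun _ _ => rfl, fun h' => h'.congr (fun t ht => (e t ht).symm) fun _ _ => rfl⟩

theorem Input.Matches.per_of_add {d : ℕ} (h : I.Matches i q) (h' : I.Matches (i + d) (q - d)) :
    I.Per d q :=
  per_of_codeMatch h (CodeMatch.congr h' (fun t _ => by rw [Nat.add_assoc]) fun _ _ => rfl)

theorem Input.Matches.add {d : ℕ} (h : I.Matches i q) (h' : I.Per d q) (hd : d ≤ q) :
    I.Matches (i + d) (q - d) :=
  CodeMatch.congr (codeMatch_of_per h h' hd) (fun t _ => by rw [Nat.add_assoc]) fun _ _ => rfl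

/-- Skipping position `i + d` loses no good period: such a period would reach beyond `i + q`, hence
match there for `q - d` letters, and the overlap with the match at `i` would make `d` a period. -/
theorem Input.Matches.not_good_add {d : ℕ} (h : I.Matches i q) (hr : I.reach i = i + q) (hi : 0 < i)
    (hd : 0 < d) (hdq : d ≤ q) (hper : ¬ I.Per d q) : ¬ I.Good (i + d) := by
  intro hg
  have h1 := hg.lt i hi (by omega)
  have h2 : ParamMatch.reach I.numParams I.patAt I.pat.length (i + d) ≤ I.pat.length := reach_le _
  have hr' : ParamMatch.reach I.numParams I.patAt I.pat.length i = i + q := hr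
  have h3 := (le_reach_iff (q := i + q) (by omega)).1 (hr'.symm.trans_le h1.le)
  refine hper (h.per_of_add ((Input.matches_iff_per (by omega)).2 ?_))
  rwa [show i + d + (q - d) = i + q by omega]

/-- The table of good periods below `b`: `cnt` pairs of a period and its reach, stored from cell
`3 * K` on; `rl` is the last reach. -/
structure PeriodTable (I : Input) (b cnt rl : ℕ) (mem : ℕ → ℕ) : Prop where
  mono : ∀ l' < cnt, ∀ l < l', mem (3 * I.numParams + 2 * l) < mem (3 * I.numParams + 2 * l')
  good : ∀ l < cnt, I.Good (mem (3 * I.numParams + 2 * l))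
  lt : ∀ l < cnt, mem (3 * I.numParams + 2 * l) < b
  reach : ∀ l < cnt, mem (3 * I.numParams + 2 * l + 1) = I.reach (mem (3 * I.numParams + 2 * l))
  complete : ∀ p < b, I.Good p → ∃ l < cnt, mem (3 * I.numParams + 2 * l) = p
  le_last : ∀ l < cnt, mem (3 * I.numParams + 2 * l + 1) ≤ rl
  last : rl = 0 ∨ ∃ l < cnt, rl = mem (3 * I.numParams + 2 * l + 1)

namespace PeriodTable

theorem zero : PeriodTable I b 0 0 mem ↔ ∀ p < b, ¬ I.Good p := by
  refine ⟨fun h p hp hg => ?_, fun h => ⟨by simp, by simp, by simp, by simp, ?_, by simp, by simp⟩⟩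
  · obtain ⟨l, hl, _⟩ := h.complete p hp hg
    omega
  · exact fun p hp hg => absurd hg (h p hp)

theorem congr (h : PeriodTable I b cnt rl mem) (e : ∀ a, 3 * I.numParams ≤ a → mem' a = mem a) :
    PeriodTable I b cnt rl mem' := by
  have e1 : ∀ l, mem' (3 * I.numParams + 2 * l) = mem (3 * I.numParams + 2 * l) :=
    fun l => e _ (by omega)
  have e2 : ∀ l, mem' (3 * I.numParams + 2 * l + 1) = mem (3 * I.numParams + 2 * l + 1) :=
    fun l => e _ (by omega)
  constructor <;> simp only [e1, e2]
  exacts [h.mono, h.good, h.lt, h.reach, h.complete, h.le_last, h.last]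

theorem extend (h : PeriodTable I b cnt rl mem) {b' : ℕ} (hb : b ≤ b')
    (hno : ∀ p, b ≤ p → p < b' → ¬ I.Good p) : PeriodTable I b' cnt rl mem := by
  refine ⟨h.mono, h.good, fun l hl => (h.lt l hl).trans_le hb, h.reach, fun p hp hg => ?_,
    h.le_last, h.last⟩
  rcases lt_or_ge p b with hpb | hpb
  · exact h.complete p hpb hg
  · exact absurd hg (hno p hpb hp)

theorem append (h : PeriodTable I b cnt rl mem) (hg : I.Good b) :
    PeriodTable I (b + 1) (cnt + 1) (I.reach b)
      (Function.update (Function.update mem (3 * I.numParams + 2 * cnt) b)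
        (3 * I.numParams + 2 * cnt + 1) (I.reach b)) := by
  set M := Function.update (Function.update mem (3 * I.numParams + 2 * cnt) b)
    (3 * I.numParams + 2 * cnt + 1) (I.reach b) with hM
  have e1 : ∀ l < cnt, M (3 * I.numParams + 2 * l) = mem (3 * I.numParams + 2 * l) := fun l hl => by
    rw [hM, Function.update_of_ne (by omega), Function.update_of_ne (by omega)]
  have e2 : ∀ l < cnt, M (3 * I.numParams + 2 * l + 1) = mem (3 * I.numParams + 2 * l + 1) :=
    fun l hl => by rw [hM, Function.update_of_ne (by omega), Function.update_of_ne (by omega)]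
  have e3 : M (3 * I.numParams + 2 * cnt) = b := by
    rw [hM, Function.update_of_ne (by omega), Function.update_self]
  have e4 : M (3 * I.numParams + 2 * cnt + 1) = I.reach b := by rw [hM, Function.update_self]
  have hs : ∀ Q : ℕ → Prop, (∀ l < cnt, Q l) → Q cnt → ∀ l < cnt + 1, Q l := by
    intro Q h1 h2 l hl
    rcases Nat.lt_succ_iff_lt_or_eq.1 hl with hl | rfl
    exacts [h1 l hl, h2]
  refine ⟨hs _ (fun l' hl' l hl => ?_) fun l hl => ?_, hs _ (fun l hl => ?_) ?_,
    hs _ (fun l hl => ?_) ?_, hs _ (fun l hl => ?_) ?_, fun p hp hp' => ?_, hs _ (fun l hl => ?_) ?_,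
    .inr ⟨cnt, by omega, e4.symm⟩⟩
  · rw [e1 l (by omega), e1 l' hl']; exact h.mono l' hl' l hl
  · rw [e1 l hl, e3]; exact h.lt l hl
  · rw [e1 l hl]; exact h.good l hl
  · rwa [e3]
  · rw [e1 l hl]; have := h.lt l hl; omega
  · rw [e3]; omega
  · rw [e1 l hl, e2 l hl]; exact h.reach l hl
  · rw [e3, e4]
  · rcases Nat.lt_succ_iff_lt_or_eq.1 hp with hp | rfl
    · obtain ⟨l, hl, e⟩ := h.complete p hp hp'
      exact ⟨l, by omega, by rwa [e1 l hl]⟩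
    · exact ⟨cnt, by omega, e3⟩
  · rw [e2 l hl, h.reach l hl]
    exact (hg.lt _ (h.good l hl).pos (h.lt l hl)).le
  · rw [e4]

/-- Comparison with the last reach alone suffices. If a smaller period reached as far as `i`,
`exists_good` would give a good one reaching as far, which is in the table and so has reach at most
`rl`. -/
theorem good_iff (h : PeriodTable I i cnt rl mem) (hi : 0 < i) :
    I.Good i ↔ (I.card + 4) * i ≤ I.reach i ∧ rl < I.reach i := by
  constructor
  · intro hg
    refine ⟨hg.le, ?_⟩
    rcases h.last with h0 | ⟨l, hl, e⟩
    · have : 4 * i ≤ (I.card + 4) * i := Nat.mul_le_mul_right _ (by omega)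
      have : (I.card + 4) * i ≤ I.reach i := hg.le
      omega
    · rw [e, h.reach l hl]
      exact hg.lt _ (h.good l hl).pos (h.lt l hl)
  · rintro ⟨hle, hlt⟩
    refine ⟨hi, hle, fun p' h0 hp' => ?_⟩
    by_contra! hge
    obtain ⟨p, hp, hg, hr, _⟩ := exists_good h0 (reach_le i) ((le_reach_iff (reach_le i)).1 hge)
      ((Nat.mul_le_mul_left _ hp'.le).trans hle)
    obtain ⟨l, hl, e⟩ := h.complete p (by omega) hg
    have h1 := h.le_last l hl
    rw [h.reach l hl, e] at h1
    exact absurd (hr.trans h1) (by simpa using hlt)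

/-- A later entry reaches farther, so its period also holds on the reach of the earlier one and
`Good.two_mul_le` applies. -/
theorem pow_le (h : PeriodTable I b cnt rl mem) : ∀ l < cnt, 2 ^ l ≤ mem (3 * I.numParams + 2 * l) := by
  intro l
  induction l with
  | zero => intro h0; exact (h.good 0 h0).pos
  | succ l ih =>
    intro hl
    have h1 := h.mono (l + 1) hl l (by omega)
    have h2 := (h.good (l + 1) hl).lt _ (h.good l (by omega)).pos h1
    have h3 := (h.good l (by omega)).two_mul_le h1 ((per_reach _).mono h2.le)
    have := ih (by omega)
    rw [pow_succ]
    omega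

theorem cnt_le (h : PeriodTable I b cnt rl mem) : cnt ≤ Nat.log 2 I.pat.length + 1 := by
  rcases cnt with _ | c
  · omega
  · have h1 := h.pow_le c (by omega)
    have h2 := (h.good c (by omega)).lt_length
    have := Nat.le_log_of_pow_le (b := 2) (by omega) (h1.trans h2.le)
    omega

/-- Let `j` be the first entry whose reach is at least `q`. Either its period is the least period of
the prefix of length `q`, or this prefix has no period that is repeated often. -/
theorem lookup (h : PeriodTable I (i + 1) cnt rl mem) (hq : q ≤ I.pat.length)
    (hi : i < I.pat.length → 0 < i ∧ I.Per i q) (j : ℕ)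
    (hlt : ∀ l < j, mem (3 * I.numParams + 2 * l + 1) < q) (d : ℕ) (hd : 0 < d) (hper : I.Per d q)
    (hle : (I.card + 4) * d ≤ q) : j < cnt ∧ mem (3 * I.numParams + 2 * j) ≤ d := by
  obtain ⟨p, hp, hg, hr, hmin⟩ := exists_good hd hq hper hle
  -- A good period beyond `i` would force `i < m`; then the prefix has the smaller period `i`,
  -- against the minimality of `p`.
  have hpi : p < i + 1 := by
    by_contra! hpi
    have := hg.lt_length
    obtain ⟨h0, h1⟩ := hi (by omega)
    exact hmin i h0 (by omega) h1
  obtain ⟨l, hl, e⟩ := h.complete p hpi hg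
  have hjl : j ≤ l := by
    by_contra! hlj
    have := hlt l hlj
    rw [h.reach l hl, e] at this
    exact absurd hr (by simpa using this)
  refine ⟨by omega, ?_⟩
  rcases hjl.lt_or_eq with hjl | rfl
  · have := h.mono l hl j hjl
    omega
  · omega

end PeriodTable

/-- The invariant of the main loop, except for the stamps. -/
structure MainInv (I : Input) (i q cnt rl : ℕ) (mem : ℕ → ℕ) (out : List ℕ) : Prop where
  pos : 0 < I.pat.length → 0 < i
  range : i + q ≤ I.pat.length ∨ I.pat.length ≤ i ∧ q ≤ I.pat.length
  matched : I.Matches i q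
  tables : Tables I.numParams I.patAt I.pat.length mem
  periods : PeriodTable I i cnt rl mem
  sorted : out.Pairwise (· < ·)
  mem_out : ∀ o, o ∈ out ↔ I.pat.length + o < i ∧ I.pat.length + o ≤ I.text.length ∧
    I.Matches (I.pat.length + o) I.pat.length

/-- The state after `q` letters have matched at position `i`, no more can match, and the result of this
has been recorded. -/
structure Stalled (I : Input) (i q cnt rl : ℕ) (mem : ℕ → ℕ) (out : List ℕ) : Prop where
  pos : 0 < I.pat.length → 0 < i
  range : i + q ≤ I.pat.length ∨ I.pat.length ≤ i ∧ q ≤ I.pat.length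
  matched : I.Matches i q
  tables : Tables I.numParams I.patAt I.pat.length mem
  periods : PeriodTable I (i + 1) cnt rl mem
  reach : i < I.pat.length → I.reach i = i + q
  sorted : out.Pairwise (· < ·)
  mem_out : ∀ o, o ∈ out ↔ I.pat.length + o < i + 1 ∧ I.pat.length + o ≤ I.text.length ∧
    I.Matches (I.pat.length + o) I.pat.length

theorem MainInv.congr (h : MainInv I i q cnt rl mem out)
    (e : ∀ a, a < I.numParams ∨ 2 * I.numParams ≤ a → mem' a = mem a) :
    MainInv I i q cnt rl mem' out :=
  ⟨h.pos, h.range, h.matched, h.tables.congr (fun a ha => e a (.inl ha)) fun l _ => e _ (.inr (by omega)),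
    h.periods.congr fun a ha => e a (.inr (by omega)), h.sorted, h.mem_out⟩

/-- More letters may be compared at position `i` after `q` matches. -/
def Input.Open (I : Input) (i q : ℕ) : Prop :=
  -- From a position inside the pattern, comparisons stop at its end, so the number of matched
  -- letters there depends on the pattern only.
  i + q < I.pat.length ∨ I.pat.length ≤ i ∧ q < I.pat.length

/-- Inside the pattern, a stall computes the reach of `i`: either the pattern ends or the period
breaks. -/
theorem MainInv.reach_eq (h : MainInv I i q cnt rl mem out)
    (hs : ¬ (I.Open i q ∧ I.Matches i (q + 1))) (hi : i < I.pat.length) : I.reach i = i + q := by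
  have h1 := h.range
  refine ParamMatch.reach_eq (by omega) ((Input.matches_iff_per (by omega)).1 h.matched)
    fun hlt hp => hs ⟨.inl hlt, (Input.matches_iff_per (by omega)).2 hp⟩

theorem MainInv.stalled_append (h : MainInv I i q cnt rl mem out)
    (hs : ¬ (I.Open i q ∧ I.Matches i (q + 1))) (hi : i < I.pat.length)
    (hg : (I.card + 4) * i ≤ i + q) (hrl : rl < i + q) :
    Stalled I i q (cnt + 1) (i + q)
      (Function.update (Function.update mem (3 * I.numParams + 2 * cnt) i)
        (3 * I.numParams + 2 * cnt + 1) (i + q)) out := by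
  have hr := h.reach_eq hs hi
  have hgood := (h.periods.good_iff (h.pos (by omega))).2 (by rw [hr]; exact ⟨hg, hrl⟩)
  have hp := h.periods.append hgood
  rw [hr] at hp
  refine ⟨h.pos, h.range, h.matched, h.tables.congr (fun a ha => ?_) fun l hl => ?_, hp,
    fun _ => hr, h.sorted, fun o => ?_⟩
  · rw [Function.update_of_ne (by omega), Function.update_of_ne (by omega)]
  · rw [Function.update_of_ne (by omega), Function.update_of_ne (by omega)]
  · rw [h.mem_out]
    exact ⟨fun h => ⟨by omega, h.2⟩, fun h => ⟨by omega, h.2⟩⟩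

theorem MainInv.stalled_skip (h : MainInv I i q cnt rl mem out)
    (hs : ¬ (I.Open i q ∧ I.Matches i (q + 1))) (hi : i < I.pat.length)
    (hg : ¬ ((I.card + 4) * i ≤ i + q ∧ rl < i + q)) : Stalled I i q cnt rl mem out := by
  have hr := h.reach_eq hs hi
  have hgood := mt (h.periods.good_iff (h.pos (by omega))).1 (by rwa [hr])
  refine ⟨h.pos, h.range, h.matched, h.tables, h.periods.extend (by omega) fun p hp hp' => ?_,
    fun _ => hr, h.sorted, fun o => ?_⟩
  · rwa [show p = i by omega]
  · rw [h.mem_out]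
    exact ⟨fun h => ⟨by omega, h.2⟩, fun h => ⟨by omega, h.2⟩⟩

theorem MainInv.periods_succ (h : MainInv I i q cnt rl mem out) (hi : I.pat.length ≤ i) :
    PeriodTable I (i + 1) cnt rl mem :=
  h.periods.extend (by omega) fun p hp hp' hg => by
    have := hg.lt_length
    omega

theorem MainInv.stalled_output (h : MainInv I i q cnt rl mem out) (hi : I.pat.length ≤ i)
    (hn : i ≤ I.text.length) (hq : I.pat.length ≤ q) :
    Stalled I i q cnt rl mem (out ++ [i - I.pat.length]) := by
  have hr := h.range
  obtain rfl : q = I.pat.length := by omega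
  refine ⟨h.pos, h.range, h.matched, h.tables, h.periods_succ hi, fun _ => by omega, ?_, fun o => ?_⟩
  · refine List.pairwise_append.2 ⟨h.sorted, List.pairwise_singleton .., fun a ha b hb => ?_⟩
    have := (h.mem_out a).1 ha
    rw [List.mem_singleton.1 hb]
    omega
  · rw [List.mem_append, h.mem_out, List.mem_singleton]
    constructor
    · rintro (h' | rfl)
      · exact ⟨by omega, h'.2⟩
      · rw [Nat.add_sub_cancel' hi]
        exact ⟨by omega, hn, h.matched⟩
    · rintro ⟨h1, h2⟩
      by_cases h3 : o = i - I.pat.length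
      · exact .inr h3
      · exact .inl ⟨by omega, h2⟩

theorem MainInv.stalled_mismatch (h : MainInv I i q cnt rl mem out) (hi : I.pat.length ≤ i)
    (hs : ¬ (I.Open i q ∧ I.Matches i (q + 1))) (hq : q < I.pat.length) :
    Stalled I i q cnt rl mem out := by
  refine ⟨h.pos, h.range, h.matched, h.tables, h.periods_succ hi, fun _ => by omega, h.sorted,
    fun o => ?_⟩
  rw [h.mem_out]
  refine ⟨fun h => ⟨by omega, h.2⟩, fun ⟨h1, h2, h3⟩ => ⟨?_, h2, h3⟩⟩
  by_contra! hlt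
  rw [show I.pat.length + o = i by omega] at h3
  exact hs ⟨.inr ⟨hi, hq⟩, CodeMatch.mono h3 (by omega)⟩

/-- An occurrence or a good period at a skipped position `i + d` would make `d` a period of the
matched prefix, which `hno` excludes. The bound on `4 * s` ensures `d ≤ q`. -/
theorem Stalled.shift (h : Stalled I i q cnt rl mem out) {s q' : ℕ} (hs : 0 < s)
    (hs' : 4 * s ≤ q + 4) (hno : ∀ d, 0 < d → d < s → ¬ I.Per d q)
    (hq' : q' = 0 ∨ q' + s = q ∧ I.Per s q) : MainInv I (i + s) q' cnt rl mem out := by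
  have hr := h.range
  refine ⟨by omega, by omega, ?_, h.tables, h.periods.extend (by omega) fun p hp hp' hg => ?_,
    h.sorted, fun o => ?_⟩
  · rcases hq' with rfl | ⟨h1, h2⟩
    · exact CodeMatch.zero
    · have := h.matched.add h2 (by omega)
      rwa [← h1, Nat.add_sub_cancel] at this
  · have hpm := hg.lt_length
    have := h.matched.not_good_add (h.reach (by omega)) (h.pos (by omega)) (d := p - i) (by omega)
      (by omega) (hno _ (by omega) (by omega))
    rw [Nat.add_sub_cancel' (by omega)] at this
    exact this hg
  · rw [h.mem_out]
    refine ⟨fun h => ⟨by omega, h.2⟩, fun ⟨h1, h2, h3⟩ => ⟨?_, h2, h3⟩⟩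
    by_contra! hlt
    refine hno (I.pat.length + o - i) (by omega) (by omega) (h.matched.per_of_add ?_)
    rw [Nat.add_sub_cancel' (by omega)]
    exact CodeMatch.mono h3 (by omega)

/-- Cell `K + a` holds the stamp `i + 1` if parameter `a` appears among the `q` letters at position
`i`, and a smaller value otherwise. -/
def Stamps (I : Input) (i q : ℕ) (mem : ℕ → ℕ) : Prop :=
  ∀ a < I.numParams, mem (I.numParams + a) ≤ i + 1 ∧
    (mem (I.numParams + a) = i + 1 ↔ ∃ t < q, I.virt (i + t) = a)

/-- Stamps grow with the position, so a shift invalidates all old ones and the array is never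
cleared. -/
theorem Stamps.add (h : Stamps I i q mem) {s : ℕ} (hs : 0 < s) : Stamps I (i + s) 0 mem := by
  intro a ha
  have := (h a ha).1
  exact ⟨by omega, iff_of_false (by omega) (by simp)⟩

theorem Stamps.succ_of_mem (h : Stamps I i q mem)
    (hx : I.virt (i + q) < I.numParams → ∃ t < q, I.virt (i + t) = I.virt (i + q)) :
    Stamps I i (q + 1) mem := by
  intro a ha
  refine ⟨(h a ha).1, (h a ha).2.trans ⟨fun ⟨t, ht, e⟩ => ⟨t, by omega, e⟩, fun ⟨t, ht, e⟩ => ?_⟩⟩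
  rcases Nat.lt_succ_iff_lt_or_eq.1 ht with ht | rfl
  · exact ⟨t, ht, e⟩
  · rw [← e]
    exact hx (e ▸ ha)

theorem Stamps.succ_update (h : Stamps I i q mem) :
    Stamps I i (q + 1) (Function.update mem (I.numParams + I.virt (i + q)) (i + 1)) := by
  intro a ha
  by_cases e : I.virt (i + q) = a
  · rw [e, Function.update_self]
    exact ⟨le_rfl, iff_of_true rfl ⟨q, by omega, e⟩⟩
  · rw [Function.update_of_ne (by omega)]
    refine ⟨(h a ha).1, (h a ha).2.trans ⟨fun ⟨t, ht, e⟩ => ⟨t, by omega, e⟩, fun ⟨t, ht, e'⟩ => ?_⟩⟩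
    rcases Nat.lt_succ_iff_lt_or_eq.1 ht with ht | rfl
    · exact ⟨t, ht, e'⟩
    · exact absurd e' e

/-- Every parameter among the matched letters appears at the first position of some parameter of the
pattern. -/
theorem exists_first (hT : Tables I.numParams I.patAt I.pat.length mem) (h : I.Matches i q)
    (hq : q ≤ I.pat.length) {a : ℕ} (ha : a < I.numParams) :
    (∃ l < I.card, mem (2 * I.numParams + l) < q ∧ I.virt (i + mem (2 * I.numParams + l)) = a) ↔
      ∃ t < q, I.virt (i + t) = a := by
  refine ⟨fun ⟨l, _, h1, h2⟩ => ⟨_, h1, h2⟩, fun ⟨t, ht, e⟩ => ?_⟩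
  have h1 : I.virt (i + t) = I.patAt t ∨ I.virt (i + t) < I.numParams ∧ I.patAt t < I.numParams :=
    h.1 t ht
  obtain ⟨l, hl, h2, h3⟩ := hT.list t (by omega) (by omega)
  exact ⟨l, hl, by omega, ((h.2 _ (by omega) t ht).2 h3).trans e⟩

end Invariants

end ParamMatch

/-! ### Correctness and cost of the pieces of a search step. -/

namespace ParamMatch

section Search

open ParamMatch.Expr ParamMatch.Cmd ParamMatch.Op

variable {I : Input} {W S : ℕ} {σ : State 10} {Q : ℕ → State 10 → Prop}

theorem eval_and {k : ℕ} {τ : State k} {a b : Expr k} {p r : Prop} [Decidable p] [Decidable r]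
    (hW : 1 < W) (ha : a.eval I W S τ = some (if p then 1 else 0))
    (hb : b.eval I W S τ = some (if r then 1 else 0)) :
    (bin mul a b).eval I W S τ = some (if p ∧ r then 1 else 0) := by
  have h0 : 0 < W := by omega
  by_cases hp : p <;> by_cases hr : r <;> simp [Expr.eval, Op.eval, word, ha, hb, hp, hr, hW, h0]

/-- Addition serves as disjunction only for exclusive conditions, since the result has to be `0` or
`1`. -/
theorem eval_or {k : ℕ} {τ : State k} {a b : Expr k} {p r : Prop} [Decidable p] [Decidable r]
    (hW : 1 < W) (hpr : p → ¬ r) (ha : a.eval I W S τ = some (if p then 1 else 0))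
    (hb : b.eval I W S τ = some (if r then 1 else 0)) :
    (bin add a b).eval I W S τ = some (if p ∨ r then 1 else 0) := by
  have h0 : 0 < W := by omega
  by_cases hp : p
  · simp [Expr.eval, Op.eval, word, ha, hb, hp, hpr hp, hW]
  · by_cases hr : r <;> simp [Expr.eval, Op.eval, word, ha, hb, hp, hr, hW, h0]

/-- The registers other than scratch registers and the output are the same in both states. -/
structure Frame (σ σ' : State 10) : Prop where
  -- Register 1 holds the number of parameters of the pattern, 2 the position, 3 the number of
  -- matched letters, 4 the number of table entries, 8 the last reach. The others are scratch.
  np : σ'.reg 1 = σ.reg 1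
  i : σ'.reg 2 = σ.reg 2
  q : σ'.reg 3 = σ.reg 3
  cnt : σ'.reg 4 = σ.reg 4
  rl : σ'.reg 8 = σ.reg 8
  out : σ'.out = σ.out

/-- Compare the next letters: set register 7 to `1` and update the stamps if one more letter matches,
and set register 7 to `0` otherwise. -/
def compareNext : Cmd 10 :=
  seq (assign 7 (lit 0))
    (cond (bin add (bin lt (bin add (reg 2) (reg 3)) patLen)
        (bin mul (bin lt patLen (bin add (reg 2) (lit 1))) (bin lt (reg 3) patLen)))
      (seq (readAt 5 (bin add (reg 2) (reg 3)))
        (seq (assign 6 (pat (reg 3)))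
          (cond (bin lt (reg 6) numParams)
            (seq (assign 0 (bin sub (mem (reg 6)) (lit 1)))
              -- Register 0 is the first position of the pattern letter. If it is not before `q`,
              -- the parameter is new, and the letter read must be a parameter without a current
              -- stamp.
              (cond (bin lt (reg 0) (reg 3))
                (seq (readAt 9 (bin add (reg 2) (reg 0))) (assign 7 (bin eq (reg 5) (reg 9))))
                (cond (bin lt (reg 5) numParams)
                  (cond (bin eq (mem (bin add numParams (reg 5))) (bin add (reg 2) (lit 1))) skip
                    (seq (store (bin add numParams (reg 5)) (bin add (reg 2) (lit 1)))
                      (assign 7 (lit 1))))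
                  skip)))
            (assign 7 (bin eq (reg 5) (reg 6))))))
      skip)

theorem compareNext_terminates (h : Admissible I W S) {cnt rl : ℕ} {out : List ℕ}
    (hM : MainInv I (σ.reg 2) (σ.reg 3) cnt rl σ.mem out) (hS : Stamps I (σ.reg 2) (σ.reg 3) σ.mem)
    (hn : σ.reg 2 ≤ I.text.length)
    (hit : ∀ t ≤ 100, ∀ σ', Frame σ σ' → σ'.reg 7 = 1 →
      (∀ a, a < I.numParams ∨ 2 * I.numParams ≤ a → σ'.mem a = σ.mem a) → I.Open (σ.reg 2) (σ.reg 3) →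
      I.Matches (σ.reg 2) (σ.reg 3 + 1) → Stamps I (σ.reg 2) (σ.reg 3 + 1) σ'.mem → Q t σ')
    (miss : ∀ t ≤ 100, ∀ σ', Frame σ σ' → σ'.reg 7 = 0 → σ'.mem = σ.mem →
      ¬ (I.Open (σ.reg 2) (σ.reg 3) ∧ I.Matches (σ.reg 2) (σ.reg 3 + 1)) → Q t σ') :
    Terminates I W S compareNext σ Q := by
  have hl := h.linear
  have hs := h.space
  have hr := hM.range
  refine .seq (.assign (v := 0) ?_ ?_)
  · simp (disch := omega) [Expr.eval, word_of_lt]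
  refine .cond (p := σ.reg 2 + σ.reg 3 < I.pat.length ∨
    I.pat.length ≤ σ.reg 2 ∧ σ.reg 3 < I.pat.length) ?_ (fun ho => ?_) fun ho => ?_
  · refine eval_or (by omega) (by omega) ?_ (eval_and (by omega) ?_ ?_)
    · simp (disch := omega) [Expr.eval, Op.eval, word_of_lt, word_ite]
    · simp (disch := omega) [Expr.eval, Op.eval, word_of_lt, word_ite]
    · simp (disch := omega) [Expr.eval, Op.eval, word_of_lt, word_ite]
  swap
  · exact .skip (miss _ (by simp [Expr.cost]) _ ⟨by simp, by simp, by simp, by simp, by simp, rfl⟩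
      (by simp) rfl fun h => ho h.1)
  refine .seq (readAt_terminates h (x := σ.reg 2 + σ.reg 3) ?_ (by omega) fun t₁ ht₁ => .seq ?_)
  · simp (disch := omega) [Expr.eval, Op.eval, word_of_lt]
  simp only [Expr.cost] at ht₁
  refine .assign (v := I.patAt (σ.reg 3)) ?_ ?_
  · simp [Expr.eval, h.eval_pat (show σ.reg 3 < I.pat.length by omega)]
  have hm := hM.matched
  refine .cond (p := I.patAt (σ.reg 3) < I.numParams) ?_ (fun hK => ?_) fun hK => ?_
  · simp (disch := omega) [Expr.eval, Op.eval, word_of_lt, word_ite]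
  swap
  · have hiff := CodeMatch.succ_of_const hm (not_lt.1 hK)
    by_cases e : I.virt (σ.reg 2 + σ.reg 3) = I.patAt (σ.reg 3)
    · refine .assign (v := 1) ?_ (hit _ ?_ _ ?_ ?_ (fun _ _ => rfl) ho (hiff.2 e) ?_)
      · simp (disch := omega) [Expr.eval, Op.eval, word_of_lt, e]
      · simp [Expr.cost]; omega
      · exact ⟨by simp, by simp, by simp, by simp, by simp, rfl⟩
      · simp
      · exact hS.succ_of_mem fun hlt => absurd hlt (e ▸ hK)
    · refine .assign (v := 0) ?_ (miss _ ?_ _ ?_ ?_ rfl fun h => e (hiff.1 h.2))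
      · simp (disch := omega) [Expr.eval, Op.eval, word_of_lt, e]
      · simp [Expr.cost]; omega
      · exact ⟨by simp, by simp, by simp, by simp, by simp, rfl⟩
      · simp
  obtain ⟨j, hj, hF, hPj, hnew⟩ := hM.tables.first (σ.reg 3) (by omega) hK
  refine .seq (.assign (v := j) ?_ ?_)
  · have : I.patAt (σ.reg 3) < S := by omega
    simp (disch := omega) [Expr.eval, Op.eval, word_of_lt, this, hF]
  refine .cond (p := j < σ.reg 3) ?_ (fun hlt => ?_) fun hge => ?_
  · simp (disch := omega) [Expr.eval, Op.eval, word_ite]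
  · have hiff := CodeMatch.succ_of_old hm hlt hPj hK
    refine .seq (readAt_terminates h (x := σ.reg 2 + j) ?_ (by omega) fun t₂ ht₂ => ?_)
    · simp (disch := omega) [Expr.eval, Op.eval, word_of_lt]
    simp only [Expr.cost] at ht₂
    by_cases e : I.virt (σ.reg 2 + σ.reg 3) = I.virt (σ.reg 2 + j)
    · refine .assign (v := 1) ?_ (hit _ ?_ _ ?_ ?_ (fun _ _ => rfl) ho (hiff.2 e) ?_)
      · simp (disch := omega) [Expr.eval, Op.eval, word_of_lt, e]
      · simp [Expr.cost]; omega
      · exact ⟨by simp, by simp, by simp, by simp, by simp, rfl⟩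
      · simp
      · exact hS.succ_of_mem fun _ => ⟨j, hlt, e.symm⟩
    · refine .assign (v := 0) ?_ (miss _ ?_ _ ?_ ?_ rfl fun h => e (hiff.1 h.2))
      · simp (disch := omega) [Expr.eval, Op.eval, word_of_lt, e]
      · simp [Expr.cost]; omega
      · exact ⟨by simp, by simp, by simp, by simp, by simp, rfl⟩
      · simp
  obtain rfl : j = σ.reg 3 := by omega
  have hiff := CodeMatch.succ_of_new hm hnew hK
  refine .cond (p := I.virt (σ.reg 2 + σ.reg 3) < I.numParams) ?_ (fun ha => ?_) fun ha => ?_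
  · simp (disch := omega) [Expr.eval, Op.eval, word_of_lt, word_ite]
  swap
  · refine .skip (miss _ ?_ _ ?_ ?_ rfl fun h => ha (hiff.1 h.2).1)
    · simp [Expr.cost]; omega
    · exact ⟨by simp, by simp, by simp, by simp, by simp, rfl⟩
    · simp
  have hst := (hS _ ha).2
  refine .cond (p := σ.mem (I.numParams + I.virt (σ.reg 2 + σ.reg 3)) = σ.reg 2 + 1) ?_
    (fun hz => ?_) fun hz => ?_
  · have : I.numParams + I.virt (σ.reg 2 + σ.reg 3) < S := by omega
    simp (disch := omega) [Expr.eval, Op.eval, word_of_lt, word_ite, this]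
  · refine .skip (miss _ ?_ _ ?_ ?_ rfl fun h => ?_)
    · simp [Expr.cost]; omega
    · exact ⟨by simp, by simp, by simp, by simp, by simp, rfl⟩
    · simp
    · obtain ⟨t, ht, e⟩ := hst.1 hz
      exact (hiff.1 h.2).2 t ht e
  · refine .seq (.store (a := I.numParams + I.virt (σ.reg 2 + σ.reg 3)) (v := σ.reg 2 + 1) ?_
      (by omega) ?_ (.assign (v := 1) ?_ (hit _ ?_ _ ?_ ?_ (fun a ha' => ?_) ho
        (hiff.2 ⟨ha, fun t ht e => hz (hst.2 ⟨t, ht, e⟩)⟩) ?_)))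
    · simp (disch := omega) [Expr.eval, Op.eval, word_of_lt]
    · simp (disch := omega) [Expr.eval, Op.eval, word_of_lt]
    · simp (disch := omega) [Expr.eval, word_of_lt]
    · simp [Expr.cost]; omega
    · exact ⟨by simp, by simp, by simp, by simp, by simp, rfl⟩
    · simp
    · simp only [State.set_mem, State.put_mem]
      rw [Function.update_of_ne (by omega)]
    · exact hS.succ_update

/-- Record the result of the matching at the current position: a good period or an occurrence. -/
def record : Cmd 10 :=
  cond (bin lt (reg 2) patLen)
    -- The criterion of `PeriodTable.good_iff`, where the reach is `i + q` and the added `1` turns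
    -- `<` into `≤`.
    (cond (bin mul (bin lt (bin mul (bin add (reg 1) (lit 4)) (reg 2))
        (bin add (bin add (reg 2) (reg 3)) (lit 1))) (bin lt (reg 8) (bin add (reg 2) (reg 3))))
      (seq (store (bin add (bin mul (lit 3) numParams) (bin mul (lit 2) (reg 4))) (reg 2))
        (seq (assign 8 (bin add (reg 2) (reg 3)))
          (seq (store (bin add (bin add (bin mul (lit 3) numParams) (bin mul (lit 2) (reg 4))) (lit 1))
              (reg 8))
            (assign 4 (bin add (reg 4) (lit 1))))))
      skip)
    (cond (bin lt (reg 3) patLen) skip (output (bin sub (reg 2) patLen)))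

theorem Admissible.mul_lt (h : Admissible I W S) {i : ℕ} (hi : i ≤ I.text.length + I.pat.length + 1) :
    (I.card + 4) * i < W := by
  have h1 : I.card ≤ I.pat.length := card_params_le'
  have h2 := h.word
  have h3 : (I.card + 4) * i ≤ (I.pat.length + 4) * (I.text.length + I.pat.length + 1) :=
    Nat.mul_le_mul (by omega) hi
  have h4 : (I.pat.length + 4) * (I.text.length + I.pat.length + 1) ≤
      2 * (I.text.length + I.pat.length + I.numParams + 2) *
        (I.text.length + I.pat.length + I.numParams + 2) := Nat.mul_le_mul (by omega) (by omega)
  nlinarith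

theorem record_terminates (h : Admissible I W S) (hnp : σ.reg 1 = I.card)
    (hM : MainInv I (σ.reg 2) (σ.reg 3) (σ.reg 4) (σ.reg 8) σ.mem σ.out)
    (hn : σ.reg 2 ≤ I.text.length)
    (hs : ¬ (I.Open (σ.reg 2) (σ.reg 3) ∧ I.Matches (σ.reg 2) (σ.reg 3 + 1)))
    (hQ : ∀ t ≤ 100, ∀ σ', σ'.reg 1 = σ.reg 1 → σ'.reg 2 = σ.reg 2 → σ'.reg 3 = σ.reg 3 →
      Stalled I (σ.reg 2) (σ.reg 3) (σ'.reg 4) (σ'.reg 8) σ'.mem σ'.out →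
      (∀ a < I.numParams, σ'.mem (I.numParams + a) = σ.mem (I.numParams + a)) → Q t σ') :
    Terminates I W S record σ Q := by
  have hl := h.linear
  have hsp := h.space
  have hr := hM.range
  have hmul := h.mul_lt (i := σ.reg 2) (by omega)
  have hcard : I.card ≤ I.pat.length := card_params_le'
  have hcnt := hM.periods.cnt_le
  have hlog := Nat.log_le_self 2 I.pat.length
  refine .cond (p := σ.reg 2 < I.pat.length) ?_ (fun hi => ?_) fun hi => ?_
  · simp (disch := omega) [Expr.eval, Op.eval, word_of_lt, word_ite]
  · refine .cond (p := (I.card + 4) * σ.reg 2 ≤ σ.reg 2 + σ.reg 3 ∧ σ.reg 8 < σ.reg 2 + σ.reg 3)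
      ?_ (fun hp => ?_) fun hp => ?_
    · refine eval_and (by omega) ?_ ?_
      · simp (disch := omega) [Expr.eval, Op.eval, word_of_lt, word_ite, hnp]
      · simp (disch := omega) [Expr.eval, Op.eval, word_of_lt, word_ite]
    · refine .seq (.store (a := 3 * I.numParams + 2 * σ.reg 4) (v := σ.reg 2) ?_ (by omega) ?_
        (.seq (.assign (v := σ.reg 2 + σ.reg 3) ?_
          (.seq (.store (a := 3 * I.numParams + 2 * σ.reg 4 + 1) (v := σ.reg 2 + σ.reg 3) ?_
            (by omega) ?_ (.assign (v := σ.reg 4 + 1) ?_ (hQ _ ?_ _ ?_ ?_ ?_ ?_ fun a ha => ?_)))))))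
      · simp (disch := omega) [Expr.eval, Op.eval, word_of_lt]
      · simp [Expr.eval]
      · simp (disch := omega) [Expr.eval, Op.eval, word_of_lt]
      · simp (disch := omega) [Expr.eval, Op.eval, word_of_lt]
      · simp [Expr.eval]
      · simp (disch := omega) [Expr.eval, Op.eval, word_of_lt]
      · simp [Expr.cost]
      · simp
      · simp
      · simp
      · simpa using hM.stalled_append hs hi hp.1 hp.2
      · simp only [State.set_mem, State.put_mem]
        rw [Function.update_of_ne (by omega), Function.update_of_ne (by omega)]
    · exact .skip (hQ _ (by simp [Expr.cost]) _ rfl rfl rfl (hM.stalled_skip hs hi hp) fun _ _ => rfl)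
  · refine .cond (p := σ.reg 3 < I.pat.length) ?_ (fun hq => ?_) fun hq => ?_
    · simp (disch := omega) [Expr.eval, Op.eval, word_of_lt, word_ite]
    · exact .skip (hQ _ (by simp [Expr.cost]) _ rfl rfl rfl
        (hM.stalled_mismatch (not_lt.1 hi) hs hq) fun _ _ => rfl)
    · refine .output (v := σ.reg 2 - I.pat.length) ?_ (hQ _ (by simp [Expr.cost]) _ rfl rfl rfl
        (hM.stalled_output (not_lt.1 hi) hn (not_lt.1 hq)) fun _ _ => rfl)
      simp (disch := omega) [Expr.eval, Op.eval, word_of_lt]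

/-- The cell that holds the period of the table entry with the index in register 0. -/
def entryCell : Expr 10 := bin add (bin mul (lit 3) numParams) (bin mul (lit 2) (reg 0))

/-- Restart the matching after a shift by somewhat more than `q / k`. -/
def restart : Cmd 10 :=
  seq (assign 2 (bin add (reg 2) (bin add (bin div (reg 3) (bin add (reg 1) (lit 4))) (lit 1))))
    (assign 3 (lit 0))

/-- Shift the pattern by the least period of the matched prefix, if it is repeated often. -/
def shiftPattern : Cmd 10 :=
  seq (assign 0 (lit 0))
    (seq (loop (bin mul (bin lt (reg 0) (reg 4)) (bin lt (mem (bin add entryCell (lit 1))) (reg 3)))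
        (assign 0 (bin add (reg 0) (lit 1))))
      (cond (bin lt (reg 0) (reg 4))
        (cond (bin lt (mem entryCell)
            (bin add (bin div (reg 3) (bin add (reg 1) (lit 4))) (lit 1)))
          (seq (assign 5 (mem entryCell))
            (seq (assign 2 (bin add (reg 2) (reg 5))) (assign 3 (bin sub (reg 3) (reg 5)))))
          restart)
        restart))

/-- The inequalities passed to `hQ` feed the amortization: the time is linear in the shift `s`, a
shift loses at most `(I.card + 4) * s` matched letters, and `s` is not much larger than `q / (I.card
+ 4)`. -/
theorem shiftPattern_terminates (h : Admissible I W S) (hnp : σ.reg 1 = I.card)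
    (hM : Stalled I (σ.reg 2) (σ.reg 3) (σ.reg 4) (σ.reg 8) σ.mem σ.out)
    (hn : σ.reg 2 ≤ I.text.length)
    (hQ : ∀ s q' t σ', t ≤ 100 * s + 100 → 0 < s → (I.card + 4) * s ≤ σ.reg 3 + (I.card + 4) →
      σ.reg 3 ≤ q' + (I.card + 4) * s → (0 < q' → q' + s ≤ σ.reg 3) → σ'.reg 1 = σ.reg 1 → σ'.reg 2 = σ.reg 2 + s → σ'.reg 3 = q' →
      σ'.mem = σ.mem →
      MainInv I (σ.reg 2 + s) q' (σ'.reg 4) (σ'.reg 8) σ'.mem σ'.out → Q t σ') :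
    Terminates I W S shiftPattern σ Q := by
  have hl := h.linear
  have hsp := h.space
  have hr := hM.range
  have hqm : σ.reg 3 ≤ I.pat.length := by omega
  have hcard : I.card ≤ I.pat.length := card_params_le'
  have hcnt := hM.periods.cnt_le
  have hlog := Nat.log_le_self 2 I.pat.length
  have hqk : σ.reg 3 / (I.card + 4) ≤ σ.reg 3 := Nat.div_le_self _ _
  have hk : 0 < I.card + 4 := by omega
  have hlook := hM.periods.lookup hqm fun hi => ⟨hM.pos (by omega),
    ((le_reach_iff (by omega)).1 (hM.reach hi).ge).mono (Nat.le_add_left _ _)⟩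
  refine .seq (.assign (v := 0) ?_ (.seq ?_))
  · simp (disch := omega) [Expr.eval, word_of_lt]
  refine .loop (fun t σ' => Frame σ σ' ∧ σ'.mem = σ.mem ∧ t ≤ 30 * σ'.reg 0 ∧ σ'.reg 0 ≤ σ.reg 4 ∧
      ∀ l < σ'.reg 0, σ.mem (3 * I.numParams + 2 * l + 1) < σ.reg 3) (30 * σ.reg 4)
    (fun t σ' hi => by omega)
    (fun σ' => σ'.reg 0 < σ.reg 4 ∧ σ.mem (3 * I.numParams + 2 * σ'.reg 0 + 1) < σ.reg 3)
    ?_ ?_ ?_ ?_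
  · rintro t σ' ⟨hF, hmem, ht, hj, hlt⟩
    -- Both factors of the loop condition are evaluated, so the cell behind the last entry is read
    -- too and has to exist.
    have : 3 * I.numParams + 2 * σ'.reg 0 + 1 < S := by omega
    refine eval_and (by omega) ?_ ?_
    · simp (disch := omega) [Expr.eval, Op.eval, word_ite, hF.cnt]
    · simp (disch := omega) [Expr.eval, entryCell, Op.eval, word_of_lt, word_ite, this, hmem, hF.q]
  · rintro t σ' ⟨hF, hmem, ht, hj, hlt⟩ ⟨h1, h2⟩
    refine .assign (v := σ'.reg 0 + 1) ?_ ⟨?_, hmem, ?_, ?_, fun l hl' => ?_⟩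
    · simp (disch := omega) [Expr.eval, Op.eval, word_of_lt]
    · exact ⟨by simp [hF.np], by simp [hF.i], by simp [hF.q], by simp [hF.cnt], by simp [hF.rl], hF.out⟩
    · simp [Expr.cost, entryCell]; omega
    · simp; omega
    · simp only [State.set_reg, if_pos] at hl'
      rcases Nat.lt_succ_iff_lt_or_eq.1 hl' with hl' | rfl
      exacts [hlt l hl', h2]
  swap
  · exact ⟨⟨by simp, by simp, by simp, by simp, by simp, rfl⟩, rfl, by simp, by simp, by simp⟩
  rintro t σ' ⟨hF, hmem, ht, hj, hlt⟩ hdone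
  have hlook := hlook _ hlt
  -- Each passed entry has reach less than `q`, hence period at most `q / k`. The period with index
  -- `j` is at least `2 ^ j > j`, so the scan is paid for by a shift of `q / k + 1`.
  have hpass : σ'.reg 0 ≤ σ.reg 3 / (I.card + 4) + 1 := by
    rcases hj0 : σ'.reg 0 with _ | j
    · exact Nat.zero_le _
    have h1 := hlt j (by omega)
    have h2 := hM.periods.pow_le j (by omega)
    have h3 : (I.card + 4) * _ ≤ _ := (hM.periods.good j (by omega)).le
    rw [hM.periods.reach j (by omega)] at h1
    have h4 : σ.mem (3 * I.numParams + 2 * j) ≤ σ.reg 3 / (I.card + 4) :=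
      (Nat.le_div_iff_mul_le hk).2 (by rw [mul_comm]; exact (h3.trans_lt h1).le)
    have := Nat.lt_two_pow_self (n := j)
    omega
  have hdiv : (I.card + 4) * (σ.reg 3 / (I.card + 4)) ≤ σ.reg 3 := Nat.mul_div_le _ _
  have hdiv' : σ.reg 3 < (I.card + 4) * (σ.reg 3 / (I.card + 4) + 1) := Nat.lt_mul_div_succ _ hk
  have hdiv4 : 4 * (σ.reg 3 / (I.card + 4)) ≤ (I.card + 4) * (σ.reg 3 / (I.card + 4)) :=
    Nat.mul_le_mul_right _ (by omega)
  -- Shared by both branches that restart; `t'` stands for the cost of the tests in front of the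
  -- restart.
  have hrestart : (∀ d, 0 < d → (I.card + 4) * d ≤ σ.reg 3 → ¬ I.Per d (σ.reg 3)) → ∀ t' ≤ 68,
      Terminates I W S restart σ' fun t'' σ'' => Q (1 + (lit 0 : Expr 10).cost + (t + (1 + (bin mul
        (bin lt (reg 0) (reg 4)) (bin lt (mem (bin add entryCell (lit 1))) (reg 3)) : Expr 10).cost)
          + (t' + t''))) σ'' := by
    intro hno t' ht'
    refine .seq (.assign (v := σ.reg 2 + (σ.reg 3 / (I.card + 4) + 1)) ?_ (.assign (v := 0) ?_
      (hQ (σ.reg 3 / (I.card + 4) + 1) 0 _ _ ?_ ?_ ?_ ?_ ?_ ?_ ?_ ?_ ?_ ?_)))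
    · simp (disch := omega) [Expr.eval, Op.eval, word_of_lt, hF.np, hF.i, hF.q, hnp]
    · simp (disch := omega) [Expr.eval, word_of_lt]
    · simp [Expr.cost, entryCell]; omega
    · omega
    · rw [mul_add, mul_one]; omega
    · omega
    · omega
    · simp [hF.np]
    · simp
    · simp
    · exact hmem
    · have hm : (I.card + 4) * (σ.reg 3 / (I.card + 4) + 1) =
          (I.card + 4) * (σ.reg 3 / (I.card + 4)) + (I.card + 4) := by ring
      have := hM.shift (s := σ.reg 3 / (I.card + 4) + 1) (q' := 0) (by omega) (by omega)
        (fun d hd hds => hno d hd ?_) (.inl rfl)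
      · simpa [hF.cnt, hF.rl, hF.out, hmem] using this
      · exact (Nat.mul_le_mul_left _ (by omega : d ≤ _)).trans hdiv
  refine .cond (p := σ'.reg 0 < σ.reg 4) ?_ (fun hjc => ?_) fun hjc => ?_
  · simp (disch := omega) [Expr.eval, Op.eval, word_ite, hF.cnt]
  swap
  · refine (hrestart (fun d hd hd' hper => hjc (hlook _ hd hper hd').1) 4 (by omega)).imp
      fun t'' σ'' hq => ?_
    simpa only [Expr.cost] using hq
  have hS : 3 * I.numParams + 2 * σ'.reg 0 < S := by omega
  refine .cond (p := σ.mem (3 * I.numParams + 2 * σ'.reg 0) < σ.reg 3 / (I.card + 4) + 1) ?_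
    (fun hp => ?_) fun hp => ?_
  · simp (disch := omega) [Expr.eval, entryCell, Op.eval, word_of_lt, word_ite, hF.q, hF.np, hnp, hS,
      hmem]
  swap
  · refine (hrestart (fun d hd hd' hper => hp ?_) 21 (by omega)).imp fun t'' σ'' hq => ?_
    · have : d ≤ σ.reg 3 / (I.card + 4) :=
        (Nat.le_div_iff_mul_le hk).2 (by rw [mul_comm]; exact hd')
      have := (hlook _ hd hper hd').2
      omega
    · have e : ∀ a b : ℕ, a + (b + (4 + (17 + t''))) = a + (b + (21 + t'')) := fun a b => by omega
      simpa [Expr.cost, entryCell, e] using hq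
  set p := σ.mem (3 * I.numParams + 2 * σ'.reg 0) with hpdef
  have hkp : (I.card + 4) * p ≤ σ.reg 3 :=
    (Nat.mul_le_mul_left _ (Nat.lt_succ_iff.1 hp)).trans hdiv
  have h4p : 4 * p ≤ (I.card + 4) * p := Nat.mul_le_mul_right _ (by omega)
  have h1p : (I.card + 4) * p = (I.card + 3) * p + p := by ring
  -- The number of passed entries is less than `p`, so the shift by `p` pays for the scan.
  have hpow := hM.periods.pow_le _ hjc
  have hpow' := Nat.lt_two_pow_self (n := σ'.reg 0)
  have hper : I.Per p (σ.reg 3) := by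
    have h1 : σ.reg 3 ≤ σ.mem (3 * I.numParams + 2 * σ'.reg 0 + 1) := by
      by_contra! hh
      exact hdone ⟨hjc, hh⟩
    rw [hM.periods.reach _ hjc] at h1
    exact (per_reach _).mono h1
  refine .seq (.assign (v := p) ?_ (.seq (.assign (v := σ.reg 2 + p) ?_
    (.assign (v := σ.reg 3 - p) ?_ (hQ p (σ.reg 3 - p) _ _ ?_ ?_ ?_ ?_ ?_ ?_ ?_ ?_ ?_ ?_)))))
  · simp (disch := omega) [Expr.eval, entryCell, Op.eval, word_of_lt, hS, hmem, hpdef]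
  · simp (disch := omega) [Expr.eval, Op.eval, word_of_lt, hF.i]
  · simp (disch := omega) [Expr.eval, Op.eval, word_of_lt, hF.q]
  · simp [Expr.cost, entryCell]; omega
  · omega
  · omega
  · omega
  · omega
  · simp [hF.np]
  · simp
  · simp
  · exact hmem
  · have := hM.shift (s := p) (q' := σ.reg 3 - p) (by omega) (by omega)
      (fun d hd hds hd' => ?_) (.inr ⟨by omega, hper⟩)
    · simpa [hF.cnt, hF.rl, hF.out, hmem] using this
    -- A period `d < p` would also satisfy `k * d ≤ q`, and then the lookup gives `p ≤ d`.
    · have h1 := (hlook _ hd hd' ((Nat.mul_le_mul_left _ hds.le).trans hkp)).2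
      omega

/-- Stamp the parameters among the matched letters. -/
def restamp : Cmd 10 :=
  seq (assign 0 (lit 0))
    (loop (bin lt (reg 0) (reg 1))
      (seq
        (cond (bin lt (mem (bin add (bin mul (lit 2) numParams) (reg 0))) (reg 3))
          (seq (readAt 5 (bin add (reg 2) (mem (bin add (bin mul (lit 2) numParams) (reg 0)))))
            (store (bin add numParams (reg 5)) (bin add (reg 2) (lit 1))))
          skip)
        (assign 0 (bin add (reg 0) (lit 1)))))

/-- Visiting the first positions of the pattern's parameters is enough by `exists_first`. The cost
is linear in their number and not in `q`, so any positive shift pays for it. -/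
theorem restamp_terminates (h : Admissible I W S) (hnp : σ.reg 1 = I.card)
    (hM : MainInv I (σ.reg 2) (σ.reg 3) (σ.reg 4) (σ.reg 8) σ.mem σ.out)
    (hS : Stamps I (σ.reg 2) 0 σ.mem) (hn : σ.reg 2 ≤ I.text.length + I.pat.length + 1)
    (hlen : 0 < σ.reg 3 → σ.reg 2 + σ.reg 3 ≤ I.text.length + I.pat.length)
    (hQ : ∀ t ≤ 100 * I.card + 100, ∀ σ', Frame σ σ' →
      (∀ a, a < I.numParams ∨ 2 * I.numParams ≤ a → σ'.mem a = σ.mem a) →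
      Stamps I (σ.reg 2) (σ.reg 3) σ'.mem → Q t σ') :
    Terminates I W S restamp σ Q := by
  have hl := h.linear
  have hsp := h.space
  have hr := hM.range
  have hcard : I.card ≤ I.pat.length := card_params_le'
  have hcardK : I.card ≤ I.numParams := card_params_le
  refine .seq (.assign (v := 0) ?_ ?_)
  · simp (disch := omega) [Expr.eval, word_of_lt]
  refine .loop (fun t σ' => Frame σ σ' ∧ t ≤ 60 * σ'.reg 0 ∧ σ'.reg 0 ≤ I.card ∧
      (∀ a, a < I.numParams ∨ 2 * I.numParams ≤ a → σ'.mem a = σ.mem a) ∧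
      ∀ a < I.numParams, σ'.mem (I.numParams + a) ≤ σ.reg 2 + 1 ∧
        (σ'.mem (I.numParams + a) = σ.reg 2 + 1 ↔ ∃ l < σ'.reg 0, σ.mem (2 * I.numParams + l) < σ.reg 3 ∧
          I.virt (σ.reg 2 + σ.mem (2 * I.numParams + l)) = a)) (60 * I.card)
    (fun t σ' hi => by omega) (fun σ' => σ'.reg 0 < I.card) ?_ ?_ ?_ ?_
  · rintro t σ' ⟨hF, ht, hj, hmem, hst⟩
    simp (disch := omega) [Expr.eval, Op.eval, word_ite, hF.np, hnp]
  · rintro t σ' ⟨hF, ht, hj, hmem, hst⟩ hlt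
    have hlist := hM.tables.list_lt _ hlt
    have hcell : 2 * I.numParams + σ'.reg 0 < S := by omega
    have hval : σ'.mem (2 * I.numParams + σ'.reg 0) = σ.mem (2 * I.numParams + σ'.reg 0) :=
      hmem _ (.inr (by omega))
    refine .seq (.cond (p := σ.mem (2 * I.numParams + σ'.reg 0) < σ.reg 3) ?_ (fun hp => ?_)
      fun hp => ?_)
    · simp (disch := omega) [Expr.eval, Op.eval, word_of_lt, word_ite, hcell, hval, hF.q]
    · have hpar : I.virt (σ.reg 2 + σ.mem (2 * I.numParams + σ'.reg 0)) < I.numParams := by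
        have : I.virt (σ.reg 2 + σ.mem (2 * I.numParams + σ'.reg 0)) =
            I.patAt (σ.mem (2 * I.numParams + σ'.reg 0)) ∨
            I.virt (σ.reg 2 + σ.mem (2 * I.numParams + σ'.reg 0)) < I.numParams ∧
            I.patAt (σ.mem (2 * I.numParams + σ'.reg 0)) < I.numParams := hM.matched.1 _ hp
        omega
      refine .seq (readAt_terminates h (x := σ.reg 2 + σ.mem (2 * I.numParams + σ'.reg 0)) ?_ ?_
        fun t₁ ht₁ => ?_)
      · simp (disch := omega) [Expr.eval, Op.eval, word_of_lt, hcell, hval, hF.i]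
      · omega
      refine .store (a := I.numParams + I.virt (σ.reg 2 + σ.mem (2 * I.numParams + σ'.reg 0)))
        (v := σ.reg 2 + 1) ?_ (by omega) ?_ (.assign (v := σ'.reg 0 + 1) ?_
          ⟨?_, ?_, ?_, fun a ha => ?_, fun a ha => ?_⟩)
      · simp (disch := omega) [Expr.eval, Op.eval, word_of_lt]
      · simp (disch := omega) [Expr.eval, Op.eval, word_of_lt, hF.i]
      · simp (disch := omega) [Expr.eval, Op.eval, word_of_lt]
      · exact ⟨by simp [hF.np], by simp [hF.i], by simp [hF.q], by simp [hF.cnt], by simp [hF.rl],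
          hF.out⟩
      · simp only [Expr.cost] at ht₁
        simp [Expr.cost]; omega
      · simp; omega
      · simp only [State.set_mem, State.put_mem]
        rw [Function.update_of_ne (by omega), hmem a ha]
      · simp only [State.set_mem, State.put_mem, State.set_reg, if_pos]
        by_cases e : I.virt (σ.reg 2 + σ.mem (2 * I.numParams + σ'.reg 0)) = a
        · rw [e, Function.update_self]
          exact ⟨le_rfl, iff_of_true rfl ⟨_, Nat.lt_succ_self _, hp, e⟩⟩
        · rw [Function.update_of_ne (by omega)]
          refine ⟨(hst a ha).1, (hst a ha).2.trans ⟨fun ⟨l, hl, hh⟩ => ⟨l, by omega, hh⟩,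
            fun ⟨l, hl, hh⟩ => ?_⟩⟩
          rcases Nat.lt_succ_iff_lt_or_eq.1 hl with hl | rfl
          · exact ⟨l, hl, hh⟩
          · exact absurd hh.2 e
    · refine .skip (.assign (v := σ'.reg 0 + 1) ?_ ⟨?_, ?_, ?_, hmem, fun a ha => ?_⟩)
      · simp (disch := omega) [Expr.eval, Op.eval, word_of_lt]
      · exact ⟨by simp [hF.np], by simp [hF.i], by simp [hF.q], by simp [hF.cnt], by simp [hF.rl],
          hF.out⟩
      · simp [Expr.cost]; omega
      · simp; omega
      · simp only [State.set_mem, State.set_reg, if_pos]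
        refine ⟨(hst a ha).1, (hst a ha).2.trans ⟨fun ⟨l, hl, hh⟩ => ⟨l, by omega, hh⟩,
          fun ⟨l, hl, hh⟩ => ?_⟩⟩
        rcases Nat.lt_succ_iff_lt_or_eq.1 hl with hl | rfl
        · exact ⟨l, hl, hh⟩
        · exact absurd hh.1 hp
  · rintro t σ' ⟨hF, ht, hj, hmem, hst⟩ hge
    obtain hj' : σ'.reg 0 = I.card := by omega
    refine hQ _ (by simp [Expr.cost]; omega) σ' hF hmem fun a ha => ⟨(hst a ha).1, ?_⟩
    rw [(hst a ha).2, hj']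
    exact exists_first hM.tables hM.matched (by omega) ha
  · refine ⟨⟨by simp, by simp, by simp, by simp, by simp, rfl⟩, by simp, by simp, fun _ _ => rfl,
      fun a ha => ?_⟩
    have := hS a ha
    simpa using this

end Search

end ParamMatch

/-! ### The search loop and its amortized running time. -/

namespace ParamMatch

section Main

open ParamMatch.Expr ParamMatch.Cmd ParamMatch.Op

variable {I : Input} {W S : ℕ}

/-- Compare the next letters; if they do not match, record the result and move the pattern. -/
def searchStep : Cmd 10 :=
  seq compareNext
    (cond (reg 7) (assign 3 (bin add (reg 3) (lit 1))) (seq record (seq shiftPattern restamp)))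

/-- The search loop over the positions of the pattern followed by the text. -/
def search : Cmd 10 :=
  seq firstPass
    -- Position `0` matches trivially and is skipped unless the pattern is empty, when it is the
    -- first occurrence. An occurrence `o` sits at position `m + o ≤ n`, so the loop ends once the
    -- position exceeds `n`.
    (seq (assign 2 (bin lt (lit 0) patLen)) (loop (bin lt (reg 2) (bin add textLen (lit 1))) searchStep))

/-- The invariant of the search loop, including the amortized time bound. -/
structure SearchInv (I : Input) (t : ℕ) (σ : State 10) : Prop where
  -- One more matched letter pays `120` steps. A shift by `s` gains `300 * k * s` and loses at most
  -- `120 * k * s` through the decrease of `q`; the rest pays for comparing, recording, shifting and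
  -- restamping.
  time : t ≤ 300 * ((I.card + 4) * σ.reg 2) + 120 * σ.reg 3
  np : σ.reg 1 = I.card
  -- Only the last shift can lead beyond `n`, and it satisfies `k * s ≤ q + k ≤ m + k`. This keeps
  -- the factor `k` off the length of the pattern.
  mul_le : (I.card + 4) * σ.reg 2 ≤ (I.card + 4) * I.text.length + I.pat.length + (I.card + 4)
  le : σ.reg 2 ≤ I.text.length + I.pat.length + 1
  main : MainInv I (σ.reg 2) (σ.reg 3) (σ.reg 4) (σ.reg 8) σ.mem σ.out
  stamps : Stamps I (σ.reg 2) (σ.reg 3) σ.mem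

theorem SearchInv.time_le {t : ℕ} {σ : State 10} (h : SearchInv I t σ) :
    t ≤ 300 * ((I.card + 4) * I.text.length + I.pat.length + (I.card + 4)) + 120 * I.pat.length := by
  have := h.time
  have := h.mul_le
  have := h.main.range
  omega

theorem searchStep_terminates (h : Admissible I W S) {t : ℕ} {σ : State 10} (hi : SearchInv I t σ)
    (hn : σ.reg 2 ≤ I.text.length) :
    Terminates I W S searchStep σ fun t' σ' => SearchInv I (t + (6 + t')) σ' := by
  have hl := h.linear
  have hr := hi.main.range
  have htime := hi.time
  refine .seq (compareNext_terminates h hi.main hi.stamps hn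
    (fun t₁ ht₁ σ₁ hF h7 hmem hopen hmatch hst => ?_) fun t₁ ht₁ σ₁ hF h7 hmem hno => ?_)
  · refine .cond (p := σ₁.reg 7 = 1) (by simp [Expr.eval, h7]) (fun _ => ?_) fun hne => absurd h7 hne
    have hM := hi.main.congr hmem
    have hM' : MainInv I (σ.reg 2) (σ.reg 3 + 1) (σ.reg 4) (σ.reg 8) σ₁.mem σ.out := by
      refine ⟨hM.pos, ?_, hmatch, hM.tables, hM.periods, hM.sorted, hM.mem_out⟩
      unfold Input.Open at hopen
      omega
    refine .assign (v := σ.reg 3 + 1) ?_ ⟨?_, ?_, ?_, ?_, ?_, ?_⟩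
    · simp (disch := omega) [Expr.eval, Op.eval, word_of_lt, hF.q]
    · simp [Expr.cost, hF.i]; omega
    · simp [hF.np, hi.np]
    · simp only [State.set_reg, hF.i]; exact hi.mul_le
    · simp only [State.set_reg, hF.i]; exact hi.le
    · simpa [hF.i, hF.cnt, hF.rl, hF.out] using hM'
    · simpa [hF.i] using hst
  · refine .cond (p := σ₁.reg 7 = 1) (by simp [Expr.eval, h7]) (fun h7' => by omega) fun _ => ?_
    have hM₁ : MainInv I (σ₁.reg 2) (σ₁.reg 3) (σ₁.reg 4) (σ₁.reg 8) σ₁.mem σ₁.out := by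
      rw [hF.i, hF.q, hF.cnt, hF.rl, hF.out, hmem]; exact hi.main
    refine .seq (record_terminates h (by rw [hF.np, hi.np]) hM₁ (by rwa [hF.i])
      (by rwa [hF.i, hF.q]) fun t₂ ht₂ σ₂ hnp₂ hi₂ hq₂ hM₂ hst₂ => .seq ?_)
    rw [hF.np, hi.np] at hnp₂
    rw [← hi₂, ← hq₂] at hM₂
    rw [hF.i] at hi₂
    rw [hF.q] at hq₂
    refine shiftPattern_terminates h hnp₂ hM₂ (by rwa [hi₂])
      fun s q' t₃ σ₃ ht₃ hs hks hq' hsq hnp₃ hi₃ hq₃ hmem₃ hM₃ => ?_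
    rw [hi₂] at hM₃ hi₃
    rw [hq₂] at hks hq' hsq
    subst hq₃
    have hst₃ : Stamps I (σ.reg 2 + s) 0 σ₃.mem := by
      refine Stamps.add (q := σ.reg 3) (fun a ha => ?_) hs
      rw [hmem₃, hst₂ a ha, hmem]
      exact hi.stamps a ha
    rw [← hi₃] at hM₃ hst₃
    have h4s : 4 * s ≤ (I.card + 4) * s := Nat.mul_le_mul_right _ (by omega)
    have hk : (I.card + 4) * 1 ≤ (I.card + 4) * s := Nat.mul_le_mul_left _ hs
    have hs4 : 4 * s ≤ σ.reg 3 + 4 := by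
      have e1 : (I.card + 4) * s = I.card * s + 4 * s := by ring
      have e2 : I.card * 1 ≤ I.card * s := Nat.mul_le_mul_left _ hs
      omega
    refine restamp_terminates h (hnp₃.trans hnp₂) hM₃ hst₃ (by omega) (fun h0 => ?_)
      fun t₄ ht₄ σ₄ hF₄ hmem₄ hst₄ => ?_
    · have := hsq h0
      omega
    · have e : (I.card + 4) * σ₄.reg 2 = (I.card + 4) * σ.reg 2 + (I.card + 4) * s := by
        rw [hF₄.i, hi₃, mul_add]
      have hin : (I.card + 4) * σ.reg 2 ≤ (I.card + 4) * I.text.length := Nat.mul_le_mul_left _ hn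
      refine ⟨?_, ?_, ?_, ?_, ?_, ?_⟩
      · rw [e, hF₄.q]
        simp only [Expr.cost]
        omega
      · rw [hF₄.np, hnp₃, hnp₂]
      · rw [e]; omega
      · rw [hF₄.i]; omega
      · rw [hF₄.i, hF₄.q, hF₄.cnt, hF₄.rl, hF₄.out]
        exact hM₃.congr hmem₄
      · rwa [hF₄.i, hF₄.q]

theorem search_terminates (h : Admissible I W S) :
    Terminates I W S search (.init 10) fun t σ => σ.out.Pairwise (· < ·) ∧
      (∀ o, o ∈ σ.out ↔ I.pat.length + o ≤ I.text.length ∧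
        I.Matches (I.pat.length + o) I.pat.length) ∧
      t ≤ 3000 * (max 1 I.card * I.text.length + I.pat.length + 1) := by
  have hl := h.linear
  have hcard : I.card ≤ I.pat.length := card_params_le'
  have hmax : (I.card + 4) * I.text.length ≤ 5 * (max 1 I.card * I.text.length) := by
    rw [← mul_assoc]
    exact Nat.mul_le_mul_right _ (by omega)
  refine .seq ((firstPass_terminates h).imp fun t₁ σ₁ ⟨hi, hm, ht₁⟩ => .seq ?_)
  refine .assign (v := if 0 < I.pat.length then 1 else 0) ?_ ?_
  · simp (disch := omega) [Expr.eval, Op.eval, word_of_lt, word_ite]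
  refine .loop (SearchInv I) _ (fun t σ hi => hi.time_le) (fun σ => σ.reg 2 ≤ I.text.length) ?_
    (fun t σ hi hn => ?_) (fun t σ hi hn => ?_) ?_
  · intro t σ hi
    have := hi.le
    simp (disch := omega) [Expr.eval, Op.eval, word_of_lt, word_ite]
  · simpa [Expr.cost] using searchStep_terminates h hi hn
  · refine ⟨hi.main.sorted, fun o => ?_, ?_⟩
    · rw [hi.main.mem_out]
      exact ⟨fun h => h.2, fun h => ⟨by omega, h⟩⟩
    · have := hi.time_le
      simp only [Expr.cost]
      omega
  · have hpos : (if 0 < I.pat.length then 1 else 0) ≤ I.pat.length := by split <;> omega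
    have hle : (if 0 < I.pat.length then 1 else 0) ≤ 1 := by split <;> omega
    generalize hv : (if 0 < I.pat.length then 1 else 0) = v at hpos hle
    refine ⟨Nat.zero_le _, ?_, ?_, ?_, ?_, ?_⟩
    · simp [hi.card, hm, Input.card]
    · simp only [State.set_reg, if_pos]
      have : (I.card + 4) * v ≤ (I.card + 4) * 1 := Nat.mul_le_mul_left _ hle
      omega
    · simp only [State.set_reg, if_pos]
      omega
    · have hT := hi.tables
      rw [hm] at hT
      have hP : PeriodTable I v 0 0 σ₁.mem := PeriodTable.zero.2 fun p hp hg => by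
        have := hg.pos
        omega
      have : MainInv I v 0 0 0 σ₁.mem [] := by
        refine ⟨fun h0 => ?_, .inl (by omega), CodeMatch.zero, hT, hP, .nil, fun o => ?_⟩
        · rw [if_pos h0] at hv
          omega
        · simp only [List.not_mem_nil, false_iff]
          rintro ⟨h1, _⟩
          omega
      simpa [hi.q, hi.cnt, hi.rlast, hi.out] using this
    · have : Stamps I v 0 σ₁.mem := fun a ha => by
        rw [hi.stamps a ha]
        exact ⟨Nat.zero_le _, iff_of_false (by omega) (by simp)⟩
      simpa [hi.q] using this

end Main

/-! ### Strings and their letter codes. -/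

section Encoding

variable {Con Par : Type*} [Fintype Par] (par : Par ≃ Fin (Fintype.card Par)) (con : Con ↪ ℕ)

theorem letterCode_injective : Function.Injective (letterCode par con) := by
  rintro (a | c) (a' | c') h
  · simp only [letterCode, Nat.add_left_cancel_iff] at h
    rw [con.injective h]
  · have := (par c').isLt
    simp only [letterCode] at h
    omega
  · have := (par c).isLt
    simp only [letterCode] at h
    omega
  · simp only [letterCode] at h
    rw [par.injective (Fin.ext h)]

theorem letterCode_inl (a : Con) : ¬ letterCode par con (.inl a) < Fintype.card Par := by
  simp [letterCode]

theorem letterCode_inr (c : Par) : letterCode par con (.inr c) < Fintype.card Par := (par c).isLt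

/-- Equal patterns of equalities define an injective map on the parameters of `x`, and on a finite
alphabet such a partial map extends to a permutation. -/
theorem pMatch_of_forall {x y : PString Con Par} (hlen : x.length = y.length)
    (h₁ : ∀ t (hx : t < x.length) (hy : t < y.length), x[t] = y[t] ∨ x[t].isRight ∧ y[t].isRight)
    (h₂ : ∀ s (hs : s < x.length) (hs' : s < y.length) t (ht : t < x.length) (ht' : t < y.length),
      x[s] = x[t] ↔ y[s] = y[t]) : PMatch x y := by
  classical
  have hex : ∀ c : Par, ∃ d : Par, ∀ t (hx : t < x.length) (hy : t < y.length),
      x[t] = .inr c → y[t] = .inr d := by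
    intro c
    by_cases hc : Sum.inr c ∈ x
    · obtain ⟨s, hs, e⟩ := List.getElem_of_mem hc
      have hd : y[s].isRight := by
        rcases h₁ s hs (hlen ▸ hs) with h | h
        · rw [← h, e]; rfl
        · exact h.2
      obtain ⟨d, hd⟩ := Sum.isRight_iff.1 hd
      exact ⟨d, fun t hx hy ht => ((h₂ t hx hy s hs (hlen ▸ hs)).1 (ht.trans e.symm)).trans hd⟩
    -- For a parameter that does not occur in `x` any value will do; injectivity is only claimed on
    -- those that occur.
    · exact ⟨c, fun t hx hy ht => absurd (ht ▸ List.getElem_mem hx) hc⟩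
  choose f₀ hf₀ using hex
  have hinj : Set.InjOn f₀ (Finset.univ.filter fun c : Par => (Sum.inr c : Con ⊕ Par) ∈ x) := by
    intro c hc c' hc' e
    simp only [Finset.coe_filter, Finset.mem_univ, true_and, Set.mem_ofPred_eq] at hc hc'
    obtain ⟨s, hs, es⟩ := List.getElem_of_mem hc
    obtain ⟨t, ht, et⟩ := List.getElem_of_mem hc'
    have h1 := hf₀ c s hs (hlen ▸ hs) es
    have h2 := hf₀ c' t ht (hlen ▸ ht) et
    have h3 := (h₂ s hs (hlen ▸ hs) t ht (hlen ▸ ht)).2 (by rw [h1, h2, e])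
    rw [es, et] at h3
    exact Sum.inr_injective h3
  obtain ⟨g, hg⟩ := Finset.exists_equiv_extend_of_card_eq (t := (Finset.univ : Finset Par))
    (by simp) (Finset.subset_univ _) hinj
  refine ⟨g.trans (Equiv.subtypeUnivEquiv Finset.mem_univ), List.ext_getElem (by simp [hlen]) ?_⟩
  intro t h1 h2
  rw [List.length_map] at h1
  rw [List.getElem_map]
  rcases hx : x[t] with a | c
  · rcases h₁ t h1 h2 with h | h
    · rw [← h, hx]; rfl
    · rw [hx] at h
      simp at h
  · rw [hf₀ c t h1 h2 hx]
    have : (Sum.inr c : Con ⊕ Par) ∈ x := hx ▸ List.getElem_mem h1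
    simpa using hg c (by simpa using this)

/-- Parameterized matching of strings is matching of their codes. -/
theorem pMatch_iff_codeMatch {x y : PString Con Par} (hlen : x.length = y.length) :
    PMatch x y ↔ CodeMatch (Fintype.card Par) (fun t => (x.map (letterCode par con)).getD t 0)
      (fun t => (y.map (letterCode par con)).getD t 0) y.length := by
  have hget : ∀ (z : PString Con Par) t (ht : t < z.length),
      (z.map (letterCode par con)).getD t 0 = letterCode par con z[t] := fun z t ht => by
    rw [List.getD_eq_getElem _ _ (by simpa using ht), List.getElem_map]
  constructor
  · rintro ⟨f, rfl⟩
    rw [List.length_map]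
    have hinj : Function.Injective (Sum.map id f : Con ⊕ Par → Con ⊕ Par) :=
      Function.Injective.sumMap Function.injective_id f.injective
    refine ⟨fun t ht => ?_, fun s hs t ht => ?_⟩
    · beta_reduce
      rw [hget _ t ht, hget _ t (by simpa using ht), List.getElem_map]
      rcases x[t] with a | c
      · exact .inl rfl
      · exact .inr ⟨letterCode_inr .., letterCode_inr ..⟩
    · beta_reduce
      rw [hget _ t ht, hget _ t (by simpa using ht), hget _ s hs, hget _ s (by simpa using hs),
        List.getElem_map, List.getElem_map, (letterCode_injective par con).eq_iff,
        (letterCode_injective par con).eq_iff, hinj.eq_iff]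
  · rintro ⟨h₁, h₂⟩
    refine pMatch_of_forall hlen (fun t hx hy => ?_) fun s hs hs' t ht ht' => ?_
    · have := h₁ t hy
      beta_reduce at this
      rw [hget _ t hx, hget _ t hy, (letterCode_injective par con).eq_iff] at this
      refine this.imp_right fun ⟨h, h'⟩ => ⟨?_, ?_⟩
      · rcases hz : x[t] with a | c
        · exact absurd (hz ▸ h) (letterCode_inl par con a)
        · rfl
      · rcases hz : y[t] with a | c
        · exact absurd (hz ▸ h') (letterCode_inl par con a)
        · rfl
    · have := h₂ s hs' t ht'
      beta_reduce at this
      rwa [hget _ t ht, hget _ t ht', hget _ s hs, hget _ s hs', (letterCode_injective par con).eq_iff,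
        (letterCode_injective par con).eq_iff] at this

theorem isOccurrence_iff (T P : PString Con Par) (i : ℕ) :
    IsOccurrence T P i ↔ P.length + i ≤ T.length ∧
      (encodeInput par con T P).Matches (P.length + i) P.length := by
  rw [IsOccurrence, Nat.add_comm i]
  refine and_congr_right fun hi => ?_
  have hlen : (substr T i (P.length + i)).length = P.length := by
    simp [substr]; omega
  rw [pMatch_iff_codeMatch par con hlen]
  have e : ∀ t < P.length, (encodeInput par con T P).virt (P.length + i + t) =
      ((substr T i (P.length + i)).map (letterCode par con)).getD t 0 := by
    intro t ht
    have h1 := Input.virt_add (I := encodeInput par con T P) (i + t)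
    have h2 : (encodeInput par con T P).pat.length = P.length := by simp [encodeInput]
    rw [h2, ← Nat.add_assoc] at h1
    rw [h1, List.getD_eq_getElem _ _ (by simp [encodeInput]; omega),
      List.getD_eq_getElem _ _ (by simpa [hlen] using ht)]
    simp [encodeInput, substr]
  exact ⟨fun h => h.congr e fun _ _ => rfl, fun h => h.congr (fun t ht => (e t ht).symm) fun _ _ => rfl⟩

theorem card_le_ncard (T P : PString Con Par) :
    (encodeInput par con T P).card ≤ (paramSet P).ncard := by
  rw [Input.card, ← Set.ncard_coe_finset]
  refine (Set.ncard_le_ncard (t := (fun c => (par c : ℕ)) '' paramSet P) (fun a ha => ?_)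
    (Set.toFinite _)).trans (Set.ncard_image_le (Set.toFinite _))
  obtain ⟨⟨t, ht, rfl⟩, hK⟩ := mem_params.1 (Finset.mem_coe.1 ha)
  have ht' : t < P.length := by simpa [encodeInput] using ht
  have e : (encodeInput par con T P).patAt t = letterCode par con P[t] := by
    simp [encodeInput, Input.patAt, ht']
  rw [e] at hK ⊢
  rcases hz : P[t] with a | c
  · exact absurd (hz ▸ hK) (letterCode_inl par con a)
  · exact ⟨c, by rw [paramSet, Set.mem_ofPred_eq, ← hz]; exact List.getElem_mem ht', rfl⟩

theorem admissible_encodeInput (T P : PString Con Par) {W C : ℕ} (hC : 8 ≤ C)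
    (hW : (T.length + P.length + Fintype.card Par + 2) ^ C ≤ W)
    (hcode : ∀ a ∈ T ++ P, letterCode par con a < W) :
    Admissible (encodeInput par con T P) W (3 * Fintype.card Par + 2 * Nat.log 2 P.length + 4) := by
  refine ⟨?_, ?_, ?_, by simp [encodeInput]⟩
  · simp only [encodeInput, List.length_map]
    refine le_trans ?_ ((Nat.pow_le_pow_right (by omega) hC).trans hW)
    -- The base is at least `2`, so its sixth power absorbs the factor `64`.
    rw [show 8 = 6 + 2 from rfl, pow_add]
    exact Nat.mul_le_mul_right _ (Nat.pow_le_pow_left (show 2 ≤ _ by omega) 6)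
  · simp only [encodeInput, List.mem_map]
    rintro _ ⟨a, ha, rfl⟩
    exact hcode a (List.mem_append_right _ ha)
  · simp only [encodeInput, List.mem_map]
    rintro _ ⟨a, ha, rfl⟩
    exact hcode a (List.mem_append_left _ ha)

end Encoding

end ParamMatch

theorem mainTheorem1 :
    ∃ (k : ℕ) (prog : ParamMatch.Cmd k) (C : ℕ),
      ∀ (Con Par : Type*) [Fintype Par]
        (par : Par ≃ Fin (Fintype.card Par)) (con : Con ↪ ℕ)
        (T P : ParamMatch.PString Con Par) (W : ℕ),
        (T.length + P.length + Fintype.card Par + 2) ^ C ≤ W →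
        (∀ a ∈ T ++ P, ParamMatch.letterCode par con a < W) →
        ∃ (S t : ℕ) (σ : ParamMatch.State k),
          ParamMatch.Exec (ParamMatch.encodeInput par con T P) W S prog
            (ParamMatch.State.init k) t σ ∧
          σ.out.Pairwise (· < ·) ∧
          (∀ i : ℕ, i ∈ σ.out ↔ ParamMatch.IsOccurrence T P i) ∧
          t ≤ C * (max 1 (ParamMatch.paramSet P).ncard * T.length + P.length + 1) ∧
          k + S ≤ C * (Nat.log 2 P.length + Fintype.card Par + 1) := by
  refine ⟨10, ParamMatch.search, 3000, fun Con Par _ par con T P W hW hcode => ?_⟩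
  obtain ⟨t, σ, hex, hsorted, hout, ht⟩ := ParamMatch.search_terminates
    (ParamMatch.admissible_encodeInput par con T P (by norm_num) hW hcode)
  have hT : (ParamMatch.encodeInput par con T P).text.length = T.length := by
    simp [ParamMatch.encodeInput]
  have hP : (ParamMatch.encodeInput par con T P).pat.length = P.length := by
    simp [ParamMatch.encodeInput]
  rw [hT, hP] at hout ht
  refine ⟨_, t, σ, hex, hsorted, fun i => ?_, ht.trans ?_, by omega⟩
  · rw [hout, ParamMatch.isOccurrence_iff par con]
  · have := ParamMatch.card_le_ncard par con T P
    gcongr
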